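/- **Theorem (Preservation for the direct-style $\lambda^*_\varepsilon$-calculus).** *Syntax.* Fix base types $B$, among them $\mathsf{Unit}$ (with the constant $\mathsf{unit}$) and $\mathsf{Alloc}$ (with the allocation capability $\omega$ as its only constant); every constant $c$ belongs to exactly one base type. Let $x,y$ range over variables and $\ell,w$ over store locations, and identify terms and types up to renaming of bound variables. - Values $v ::= c\mid\lambda x.t\mid\ell$; terms $t ::= v\mid x\mid t\,t\mid \mathsf{ref}_{t}\,t\mid {!t}\mid t:=t\mid \mathsf{let}\ x=t\ \mathsf{in}\ t$. - Qualifiers, effects and observations $p,q,r,\varepsilon,\varphi$ are finite sets of variables and locations; a comma denotes union. - Types $T ::= B\mid (x:T^q)\to^{\varepsilon}U^r\mid \mathsf{Ref}\,B$, where $x$ is bound in $\varepsilon,U,r$. - Typing environments $\Gamma$ (resp. store typings $\Sigma$) are finite sequences of bindings $x:T^q$ (resp. $\ell:T^q$) with distinct variables (resp. locations). $q[p/x]$ is $(q\setminus\{x\})\cup p$ if $x\in q$ and $q$ otherwise, extended homomorphically to types. In a context $\Gamma\mid\Sigma$, the saturation $q^*$ is the set of all atoms reachable from $q$ in zero or more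 steps, where an atom bound with qualifier $q'$ reaches in one step each element of $q'$. *Subtyping.* $\Gamma\mid\Sigma\vdash p<:q$ iff $p\subseteq q\subseteq\mathrm{dom}(\Gamma)\cup\mathrm{dom}(\Sigma)$. $\Gamma\mid\Sigma\vdash S^p\,\varepsilon_1<:T^q\,\varepsilon_2$ iff $S<:T$, $p<:q$ and $\varepsilon_1<:\varepsilon_2$. On types: $B<:B$; $\mathsf{Ref}\,B<:\mathsf{Ref}\,B$; and $(x:S^o)\to^{\varepsilon_1}T^q<:(x:U^p)\to^{\varepsilon_2}V^r$ if $\Gamma\mid\Sigma\vdash U^p\,\varnothing<:S^o\,\varnothing$ and $\Gamma,x:U^p\mid\Sigma\vdash T^q\,\varepsilon_1<:V^r\,\varepsilon_2$. *Typing.* $[\Gamma\mid\Sigma]^\varphi\vdash t:T^q\ \varepsilon$ is generated by the following rules (the context $[\Gamma\mid\Sigma]^\varphi$ is omitted where it does not change; variables bound by a term or type are chosen fresh). - $c:B^\varnothing\ \varnothing$ if $c$ belongs to $B$; $\;x:T^{\{x\}}\ \varnothing$ if $x:T^q\in\Gamma$ and $x\in\varphi$; $\;\ell:T^{\{\ell\}}\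 \varnothing$ if $\ell:T^q\in\Sigma$ and $\ell\in\varphi$. - $\lambda x.t:((x:T^p)\to^{\varepsilon}U^r)^q\ \varnothing$ if $[\Gamma,x:T^p\mid\Sigma]^{q,x}\vdash t:U^r\ \varepsilon$, $q\subseteq\varphi$, and all variables and locations in $T^p$ are bound in $\Gamma$ or $\Sigma$. - $t_1\,t_2:(U^r)[p/x]\ \ \varepsilon_1\cup\varepsilon_2\cup\varepsilon_3[p/x]$ if $t_1:((x:T^{p^*\cap q^*})\to^{\varepsilon_3}U^r)^q\ \varepsilon_1$, $t_2:T^p\ \varepsilon_2$, $p^*,q^*\subseteq\varphi$, $x\notin\mathrm{fv}(U)$, $\varepsilon_3\subseteq q,x$ and $r\subseteq\varphi,x$. - $\mathsf{let}\ x=t_1\ \mathsf{in}\ t_2:(T^q)[p/x]\ \ \varepsilon_1\cup\varepsilon_2[p/x]$ if $t_1:S^p\ \varepsilon_1$, $[\Gamma,x:S^{p^*\cap\varphi^*}\mid\Sigma]^{\varphi,x}\vdash t_2:T^q\ \varepsilon_2$ and $x\notin\mathrm{fv}(T)$. - $\mathsf{ref}_{t_1}\,t_2:(\mathsf{Ref}\,B)^\varnothing\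 \ \varepsilon_1\cup\varepsilon_2\cup q$ if $t_1:\mathsf{Alloc}^q\ \varepsilon_1$ and $t_2:B^\varnothing\ \varepsilon_2$. - $!t:B^\varnothing\ \ \varepsilon\cup q$ if $t:(\mathsf{Ref}\,B)^q\ \varepsilon$. - $t_1:=t_2:\mathsf{Unit}^\varnothing\ \ \varepsilon_1\cup\varepsilon_2\cup q$ if $t_1:(\mathsf{Ref}\,B)^q\ \varepsilon_1$ and $t_2:B^\varnothing\ \varepsilon_2$. - $t:T^q\ \varepsilon_2$ if $t:S^p\ \varepsilon_1$, $\Gamma\mid\Sigma\vdash S^p\,\varepsilon_1<:T^q\,\varepsilon_2$ and $q,\varepsilon_2\subseteq\varphi$. *Stores.* A store $\sigma$ is a finite sequence of bindings $w=\omega$ or $\ell=\mathsf{ref}_\omega\,v$. Well-formedness $[\Gamma\mid\Sigma]^\varphi\vdash\sigma$ is generated by: $[\Gamma\mid\varnothing]^\varphi\vdash\varnothing$; $[\Gamma\mid w:\mathsf{Alloc}^\varnothing]^\varphi\vdash(w=\omega)$ (the initial store); and if $[\Gamma\mid\Sigma]^\varphi\vdash\sigma$, $[\Gamma\mid\Sigma]^\varphi\vdash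 v:B^\varnothing\ \varnothing$ and $\ell\notin\mathrm{dom}(\Sigma)$, then $[\Gamma\mid\Sigma,\ell:(\mathsf{Ref}\,B)^\varnothing]^\varphi\vdash\sigma,\ell=\mathsf{ref}_\omega\,v$. *Reduction.* Evaluation contexts are $E ::= \square\mid E\,t\mid v\,E\mid\mathsf{ref}_E\,t\mid\mathsf{ref}_v\,E\mid{!E}\mid E:=t\mid v:=E\mid\mathsf{let}\ x=E\ \mathsf{in}\ t$. One-step call-by-value reduction $\sigma\mid t\longrightarrow\sigma'\mid t'$ is given by: - $\sigma\mid E[(\lambda x.t)\,v]\longrightarrow\sigma\mid E[t[v/x]]$ and $\sigma\mid E[\mathsf{let}\ x=v\ \mathsf{in}\ t]\longrightarrow\sigma\mid E[t[v/x]]$; - $\sigma\mid E[\mathsf{ref}_a\,v]\longrightarrow\sigma,\ell=\mathsf{ref}_\omega\,v\mid E[\ell]$ for $\ell\notin\mathrm{dom}(\sigma)$, where $a$ is $\omega$ or a location $w$ with $w=\omega$ in $\sigma$; - if $\sigma$ contains $\ell=\mathsf{ref}_\omega\,v$: $\sigma\mid E[!\ell]\longrightarrow\sigma\mid E[v]$,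 and $\sigma\mid E[\ell:=v']\longrightarrow\sigma'\mid E[\mathsf{unit}]$, where $\sigma'$ is $\sigma$ with that binding replaced by $\ell=\mathsf{ref}_\omega\,v'$. *Claim.* If $[\varnothing\mid\Sigma]^{\mathrm{dom}(\Sigma)}\vdash t:T^q\ \varepsilon$, $[\varnothing\mid\Sigma]^{\mathrm{dom}(\Sigma)}\vdash\sigma$ and $\sigma\mid t\longrightarrow\sigma'\mid t'$, then there are $\Sigma'\supseteq\Sigma$ and $p\subseteq\mathrm{dom}(\Sigma'\setminus\Sigma)$ such that $$[\varnothing\mid\Sigma']^{\mathrm{dom}(\Sigma')}\vdash t':T^{q\cup p}\ \ \varepsilon\cup p\qquad\text{and}\qquad[\varnothing\mid\Sigma']^{\mathrm{dom}(\Sigma')}\vdash\sigma'.$$ -/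

import Mathlib

/-!
The direct-style `λ*_ε`-calculus: a call-by-value λ-calculus with mutable references, reachability
qualifiers and effects.  Binding is represented in the locally nameless style: bound variables are
de Bruijn indices, free variables and store locations are natural numbers, and the rules that go
under a binder quantify over all fresh names `x` outside a finite set `L`.
-/

namespace LStar

universe u v

/-- Atoms of qualifiers: (bound or free) term variables and store locations. -/
inductive Atom : Type
  | bvar (i : ℕ)
  | fvar (x : ℕ)
  | loc (l : ℕ)
  deriving DecidableEq

/-- Qualifiers, effects and observations: finite sets of variables and locations. -/
abbrev Qual : Type := Finset Atom

/-- Base types: `Unit`, the type `Alloc` of allocation capabilities, and an arbitrary collection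
`K` of further base types. -/
inductive Base (K : Type u) : Type u
  | unit
  | alloc
  | ground (k : K)

/-- Types. In `fn T q ε U r`, i.e. `(x : T^q) →^ε U^r`, the argument `x` is index `0` in
`ε`, `U` and `r`. -/
inductive Ty (K : Type u) : Type u
  | base (B : Base K)
  | fn (T : Ty K) (q : Qual) (ε : Qual) (U : Ty K) (r : Qual)
  | ref (B : Base K)

/-- Constants: `unit`, the allocation capability `ω`, and the elements `C k` of base type `k`. -/
inductive Const {K : Type u} (C : K → Type v) : Type (max u v)
  | unit
  | omega
  | lit (k : K) (c : C k)

/-- The base type to which a constant belongs. -/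
def Const.ty {K : Type u} {C : K → Type v} : Const C → Base K
  | .unit => .unit
  | .omega => .alloc
  | .lit k _ => .ground k

/-- Terms; `lam t` and the second argument of `letin` bind index `0`; `ref t₁ t₂` allocates a cell
with initial content `t₂` using the capability `t₁`. -/
inductive Term {K : Type u} (C : K → Type v) : Type (max u v)
  | const (c : Const C)
  | bvar (i : ℕ)
  | fvar (x : ℕ)
  | loc (l : ℕ)
  | lam (t : Term C)
  | app (t₁ t₂ : Term C)
  | ref (t₁ t₂ : Term C)
  | deref (t : Term C)
  | assign (t₁ t₂ : Term C)
  | letin (t₁ t₂ : Term C)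

/-- Values: constants, abstractions and locations. -/
inductive Value {K : Type u} {C : K → Type v} : Term C → Prop
  | const (c : Const C) : Value (.const c)
  | lam (t : Term C) : Value (.lam t)
  | loc (l : ℕ) : Value (.loc l)

/-! ### Substitution for bound variables -/

/-- Qualifier substitution `q[p/x]` for the variable with index `k`. -/
def Qual.inst (k : ℕ) (p q : Qual) : Qual :=
  if Atom.bvar k ∈ q then q.erase (Atom.bvar k) ∪ p else q

/-- Homomorphic extension of qualifier substitution to types. -/
def Ty.inst {K : Type u} (k : ℕ) (p : Qual) : Ty K → Ty K
  | .base B => .base B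
  | .fn T q ε U r =>
      .fn (T.inst k p) (Qual.inst k p q) (Qual.inst (k + 1) p ε) (U.inst (k + 1) p)
        (Qual.inst (k + 1) p r)
  | .ref B => .ref B

/-- The variable with index `k` does not occur in the type. -/
def Ty.NotFree {K : Type u} (k : ℕ) : Ty K → Prop
  | .base _ => True
  | .fn T q ε U r =>
      T.NotFree k ∧ Atom.bvar k ∉ q ∧ Atom.bvar (k + 1) ∉ ε ∧ U.NotFree (k + 1) ∧
        Atom.bvar (k + 1) ∉ r
  | .ref _ => True

/-- Term substitution `t[s/x]` for the variable with index `k`; only used for locally closed `s`. -/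
def Term.inst {K : Type u} {C : K → Type v} (t : Term C) (k : ℕ) (s : Term C) : Term C :=
  match t with
  | .const c => .const c
  | .bvar i => if i = k then s else .bvar i
  | .fvar x => .fvar x
  | .loc l => .loc l
  | .lam t => .lam (t.inst (k + 1) s)
  | .app t₁ t₂ => .app (t₁.inst k s) (t₂.inst k s)
  | .ref t₁ t₂ => .ref (t₁.inst k s) (t₂.inst k s)
  | .deref t => .deref (t.inst k s)
  | .assign t₁ t₂ => .assign (t₁.inst k s) (t₂.inst k s)
  | .letin t₁ t₂ => .letin (t₁.inst k s) (t₂.inst (k + 1) s)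

/-- A qualifier under one binder, with the bound variable named `x`. -/
abbrev Qual.named (x : ℕ) (q : Qual) : Qual := Qual.inst 0 {Atom.fvar x} q

/-- A type under one binder, with the bound variable named `x`. -/
abbrev Ty.named {K : Type u} (x : ℕ) (T : Ty K) : Ty K := T.inst 0 {Atom.fvar x}

/-- A term under one binder, with the bound variable named `x`. -/
abbrev Term.named {K : Type u} {C : K → Type v} (x : ℕ) (t : Term C) : Term C :=
  t.inst 0 (.fvar x)

/-! ### Typing environments and store typings -/

/-- Typing environments: finite sequences of bindings `x : T^q`, latest first. -/
abbrev Ctx (K : Type u) : Type u := List (ℕ × Ty K × Qual)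

/-- Store typings: finite sequences of bindings `l : T^q`, latest first. -/
abbrev StoreTy (K : Type u) : Type u := List (ℕ × Ty K × Qual)

/-- The domain of a typing environment. -/
def domC {K : Type u} (Γ : Ctx K) : Qual := (Γ.map fun e => Atom.fvar e.1).toFinset

/-- The domain of a store typing. -/
def domS {K : Type u} (Ψ : StoreTy K) : Qual := (Ψ.map fun e => Atom.loc e.1).toFinset

/-- Every atom of `q` is in `D` or is bound by one of the `k` enclosing binders. -/
def Qual.Scoped (D : Qual) (k : ℕ) (q : Qual) : Prop :=
  ∀ a ∈ q, a ∈ D ∨ ∃ i < k, a = Atom.bvar i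

/-- All qualifiers and effects in a type under `k` binders mention only atoms of `D` and bound
variables. -/
def Ty.Scoped {K : Type u} (D : Qual) : ℕ → Ty K → Prop
  | _, .base _ => True
  | k, .fn T q ε U r =>
      T.Scoped D k ∧ Qual.Scoped D k q ∧ Qual.Scoped D (k + 1) ε ∧ U.Scoped D (k + 1) ∧
        Qual.Scoped D (k + 1) r
  | _, .ref _ => True

/-! ### Reachability -/

/-- The one-step reachability relation `a ⇝ b`: the binding of the variable or location `a` has a
qualifier that contains `b`. -/
inductive Reach {K : Type u} (Γ : Ctx K) (Ψ : StoreTy K) : Atom → Atom → Prop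
  | var {x : ℕ} {T : Ty K} {q : Qual} {b : Atom} :
      (x, T, q) ∈ Γ → b ∈ q → Reach Γ Ψ (.fvar x) b
  | loc {l : ℕ} {T : Ty K} {q : Qual} {b : Atom} :
      (l, T, q) ∈ Ψ → b ∈ q → Reach Γ Ψ (.loc l) b

/-- All atoms that occur in the outer qualifiers of a sequence of bindings. -/
def qualAtoms {K : Type u} : List (ℕ × Ty K × Qual) → Qual
  | [] => ∅
  | e :: es => e.2.2 ∪ qualAtoms es

theorem subset_qualAtoms {K : Type u} {es : List (ℕ × Ty K × Qual)} {x : ℕ} {T : Ty K} {q : Qual}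
    (h : (x, T, q) ∈ es) : q ⊆ qualAtoms es := by
  induction es with
  | nil => simp at h
  | cons e es ih =>
    rcases List.mem_cons.1 h with h | h
    · subst h
      exact Finset.subset_union_left
    · exact (ih h).trans Finset.subset_union_right

open Classical in
/-- Saturation `q*`: everything reachable from `q` in zero or more steps (see `mem_sat`). -/
noncomputable def sat {K : Type u} (Γ : Ctx K) (Ψ : StoreTy K) (q : Qual) : Qual :=
  (q ∪ (qualAtoms Γ ∪ qualAtoms Ψ)).filter
    fun b => ∃ a ∈ q, Relation.ReflTransGen (Reach Γ Ψ) a b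

open Classical in
theorem mem_sat {K : Type u} {Γ : Ctx K} {Ψ : StoreTy K} {q : Qual} {b : Atom} :
    b ∈ sat Γ Ψ q ↔ ∃ a ∈ q, Relation.ReflTransGen (Reach Γ Ψ) a b := by
  unfold sat
  rw [Finset.mem_filter]
  refine ⟨fun h => h.2, fun h => ⟨?_, h⟩⟩
  obtain ⟨a, ha, hab⟩ := h
  rcases Relation.ReflTransGen.cases_tail hab with h | ⟨c, _, hcb⟩
  · subst h
    exact Finset.mem_union_left _ ha
  · apply Finset.mem_union_right
    cases hcb with
    | var hm hb => exact Finset.mem_union_left _ (subset_qualAtoms hm hb)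
    | loc hm hb => exact Finset.mem_union_right _ (subset_qualAtoms hm hb)

/-! ### Subtyping -/

/-- Subtyping of qualifiers and of effects. -/
def QSub {K : Type u} (Γ : Ctx K) (Ψ : StoreTy K) (p q : Qual) : Prop :=
  p ⊆ q ∧ q ⊆ domC Γ ∪ domS Ψ

/-- Subtyping of ordinary types. In the rule for functions, the premises of subtyping for qualified
types with effects are written out. -/
inductive TSub {K : Type u} : Ctx K → StoreTy K → Ty K → Ty K → Prop
  | base {Γ : Ctx K} {Ψ : StoreTy K} (B : Base K) : TSub Γ Ψ (.base B) (.base B)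
  | ref {Γ : Ctx K} {Ψ : StoreTy K} (B : Base K) : TSub Γ Ψ (.ref B) (.ref B)
  | fn {Γ : Ctx K} {Ψ : StoreTy K} {S T U V : Ty K} {o p q r ε₁ ε₂ : Qual} (L : Finset ℕ) :
      TSub Γ Ψ U S →
      QSub Γ Ψ p o →
      (∀ x ∉ L, TSub ((x, U, p) :: Γ) Ψ (T.named x) (V.named x)) →
      (∀ x ∉ L, QSub ((x, U, p) :: Γ) Ψ (q.named x) (r.named x)) →
      (∀ x ∉ L, QSub ((x, U, p) :: Γ) Ψ (ε₁.named x) (ε₂.named x)) →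
      TSub Γ Ψ (.fn S o ε₁ T q) (.fn U p ε₂ V r)

/-- Subtyping `S^p ε₁ <: T^q ε₂` of qualified types with effects. -/
def QTSub {K : Type u} (Γ : Ctx K) (Ψ : StoreTy K) (S : Ty K) (p ε₁ : Qual) (T : Ty K)
    (q ε₂ : Qual) : Prop :=
  TSub Γ Ψ S T ∧ QSub Γ Ψ p q ∧ QSub Γ Ψ ε₁ ε₂

/-! ### Term typing -/

/-- `HasType Γ Ψ φ t T q ε`: under the environment `Γ`, the store typing `Ψ` and the observation
`φ`, the term `t` has the qualified type `T^q` and the effect `ε`. Sequential composition of effects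
is union. -/
inductive HasType {K : Type u} {C : K → Type v} :
    Ctx K → StoreTy K → Qual → Term C → Ty K → Qual → Qual → Prop
  | cst {Γ : Ctx K} {Ψ : StoreTy K} {φ : Qual} (c : Const C) :
      HasType Γ Ψ φ (.const c) (.base c.ty) ∅ ∅
  | var {Γ : Ctx K} {Ψ : StoreTy K} {φ : Qual} {x : ℕ} {T : Ty K} {q : Qual} :
      (x, T, q) ∈ Γ → Atom.fvar x ∈ φ →
      HasType Γ Ψ φ (.fvar x) T {Atom.fvar x} ∅
  | loc {Γ : Ctx K} {Ψ : StoreTy K} {φ : Qual} {l : ℕ} {T : Ty K} {q : Qual} :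
      (l, T, q) ∈ Ψ → Atom.loc l ∈ φ →
      HasType Γ Ψ φ (.loc l) T {Atom.loc l} ∅
  | abs {Γ : Ctx K} {Ψ : StoreTy K} {φ : Qual} {t : Term C} {T U : Ty K} {p q r ε : Qual}
      (L : Finset ℕ) :
      -- the new typing assumption `x : T^p` is well-scoped
      T.Scoped (domC Γ ∪ domS Ψ) 0 → p ⊆ domC Γ ∪ domS Ψ →
      (∀ x ∉ L, HasType ((x, T, p) :: Γ) Ψ (q ∪ {Atom.fvar x}) (t.named x)
        (U.named x) (r.named x) (ε.named x)) →
      q ⊆ φ →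
      HasType Γ Ψ φ (.lam t) (.fn T p ε U r) q ∅
  | app {Γ : Ctx K} {Ψ : StoreTy K} {φ : Qual} {t₁ t₂ : Term C} {T U : Ty K}
      {p q r ε₁ ε₂ ε₃ : Qual} :
      HasType Γ Ψ φ t₁ (.fn T (sat Γ Ψ p ∩ sat Γ Ψ q) ε₃ U r) q ε₁ →
      HasType Γ Ψ φ t₂ T p ε₂ →
      -- the intersected saturated qualifiers are observable
      sat Γ Ψ p ⊆ φ → sat Γ Ψ q ⊆ φ →
      U.NotFree 0 → ε₃ ⊆ q ∪ {Atom.bvar 0} → r ⊆ φ ∪ {Atom.bvar 0} →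
      HasType Γ Ψ φ (.app t₁ t₂) (U.inst 0 p) (Qual.inst 0 p r) (ε₁ ∪ ε₂ ∪ Qual.inst 0 p ε₃)
  | letin {Γ : Ctx K} {Ψ : StoreTy K} {φ : Qual} {t₁ t₂ : Term C} {S T : Ty K}
      {p q ε₁ ε₂ : Qual} (L : Finset ℕ) :
      HasType Γ Ψ φ t₁ S p ε₁ →
      (∀ x ∉ L, HasType ((x, S, sat Γ Ψ p ∩ sat Γ Ψ φ) :: Γ) Ψ (φ ∪ {Atom.fvar x}) (t₂.named x)
        (T.named x) (q.named x) (ε₂.named x)) →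
      T.NotFree 0 →
      HasType Γ Ψ φ (.letin t₁ t₂) (T.inst 0 p) (Qual.inst 0 p q) (ε₁ ∪ Qual.inst 0 p ε₂)
  | ref {Γ : Ctx K} {Ψ : StoreTy K} {φ : Qual} {t₁ t₂ : Term C} {B : Base K} {q ε₁ ε₂ : Qual} :
      HasType Γ Ψ φ t₁ (.base .alloc) q ε₁ →
      HasType Γ Ψ φ t₂ (.base B) ∅ ε₂ →
      HasType Γ Ψ φ (.ref t₁ t₂) (.ref B) ∅ (ε₁ ∪ ε₂ ∪ q)
  | deref {Γ : Ctx K} {Ψ : StoreTy K} {φ : Qual} {t : Term C} {B : Base K} {q ε : Qual} :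
      HasType Γ Ψ φ t (.ref B) q ε →
      HasType Γ Ψ φ (.deref t) (.base B) ∅ (ε ∪ q)
  | assign {Γ : Ctx K} {Ψ : StoreTy K} {φ : Qual} {t₁ t₂ : Term C} {B : Base K}
      {q ε₁ ε₂ : Qual} :
      HasType Γ Ψ φ t₁ (.ref B) q ε₁ →
      HasType Γ Ψ φ t₂ (.base B) ∅ ε₂ →
      HasType Γ Ψ φ (.assign t₁ t₂) (.base .unit) ∅ (ε₁ ∪ ε₂ ∪ q)
  | sub {Γ : Ctx K} {Ψ : StoreTy K} {φ : Qual} {t : Term C} {S T : Ty K} {p q ε₁ ε₂ : Qual} :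
      HasType Γ Ψ φ t S p ε₁ →
      QTSub Γ Ψ S p ε₁ T q ε₂ →
      q ⊆ φ → ε₂ ⊆ φ →
      HasType Γ Ψ φ t T q ε₂

/-! ### Stores -/

/-- Store cells: the allocation capability `ω`, or a mutable reference cell with a content. -/
inductive Cell {K : Type u} (C : K → Type v) : Type (max u v)
  | omega
  | ref (s : Term C)

/-- Stores: finite sequences of bindings of locations to cells, latest first. -/
abbrev Store {K : Type u} (C : K → Type v) : Type (max u v) := List (ℕ × Cell C)

/-- Well-formed stores. A store is built by reference allocations from the empty store or from the
initial store, which holds just the allocation capability at some location `w`. -/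
inductive StoreOK {K : Type u} {C : K → Type v} (Γ : Ctx K) (φ : Qual) :
    StoreTy K → Store C → Prop
  | empty : StoreOK Γ φ [] []
  | init (w : ℕ) : StoreOK Γ φ [(w, .base .alloc, ∅)] [(w, .omega)]
  | ref {Ψ : StoreTy K} {σ : Store C} {s : Term C} {B : Base K} {l : ℕ} :
      StoreOK Γ φ Ψ σ →
      Value s → HasType Γ Ψ φ s (.base B) ∅ ∅ →
      Atom.loc l ∉ domS Ψ →
      StoreOK Γ φ ((l, .ref B, ∅) :: Ψ) ((l, .ref s) :: σ)

/-! ### Call-by-value reduction -/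

/-- Call-by-value evaluation contexts. -/
inductive ECtx {K : Type u} (C : K → Type v) : Type (max u v)
  | hole
  | appL (E : ECtx C) (t : Term C)
  | appR (s : Term C) (hs : Value s) (E : ECtx C)
  | refL (E : ECtx C) (t : Term C)
  | refR (s : Term C) (hs : Value s) (E : ECtx C)
  | deref (E : ECtx C)
  | assignL (E : ECtx C) (t : Term C)
  | assignR (s : Term C) (hs : Value s) (E : ECtx C)
  | letin (E : ECtx C) (t : Term C)

/-- Filling the hole of an evaluation context. -/
def ECtx.plug {K : Type u} {C : K → Type v} : ECtx C → Term C → Term C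
  | .hole, a => a
  | .appL E t, a => .app (E.plug a) t
  | .appR s _ E, a => .app s (E.plug a)
  | .refL E t, a => .ref (E.plug a) t
  | .refR s _ E, a => .ref s (E.plug a)
  | .deref E, a => .deref (E.plug a)
  | .assignL E t, a => .assign (E.plug a) t
  | .assignR s _ E, a => .assign s (E.plug a)
  | .letin E t, a => .letin (E.plug a) t

/-- The term denotes the allocation capability: it is the constant `ω`, or a location at which the
store holds `ω`. -/
inductive IsCap {K : Type u} {C : K → Type v} (σ : Store C) : Term C → Prop
  | const : IsCap σ (.const .omega)
  | loc {w : ℕ} : (w, Cell.omega) ∈ σ → IsCap σ (.loc w)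

/-- Contraction of redexes. -/
inductive Head {K : Type u} {C : K → Type v} : Store C → Term C → Store C → Term C → Prop
  | beta {σ : Store C} {t s : Term C} : Value s →
      Head σ (.app (.lam t) s) σ (t.inst 0 s)
  | letin {σ : Store C} {t s : Term C} : Value s →
      Head σ (.letin s t) σ (t.inst 0 s)
  | ref {σ : Store C} {a s : Term C} {l : ℕ} : IsCap σ a → Value s →
      l ∉ σ.map Prod.fst →
      Head σ (.ref a s) ((l, .ref s) :: σ) (.loc l)
  | deref {σ₁ σ₂ : Store C} {l : ℕ} {s : Term C} :
      Head (σ₁ ++ (l, .ref s) :: σ₂) (.deref (.loc l)) (σ₁ ++ (l, .ref s) :: σ₂) s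
  | assign {σ₁ σ₂ : Store C} {l : ℕ} {s s' : Term C} : Value s' →
      Head (σ₁ ++ (l, .ref s) :: σ₂) (.assign (.loc l) s')
        (σ₁ ++ (l, .ref s') :: σ₂) (.const .unit)

/-- Single-step call-by-value reduction `σ ∣ t ⟶ σ' ∣ t'`. -/
inductive Step {K : Type u} {C : K → Type v} : Store C → Term C → Store C → Term C → Prop
  | ctx {σ σ' : Store C} {t t' : Term C} (E : ECtx C) :
      Head σ t σ' t' → Step σ (E.plug t) σ' (E.plug t')

end LStar

/-!
A step contracts a redex inside an evaluation context. The reduct is typed in a store typing `Ψ'`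
that extends `Ψ` by fresh locations `δ` of reference type, and the qualifier and effect of every
enclosing term grow by at most `δ`. In a closed context all qualifiers in the store typing are
empty, so saturation is the identity and the context rules can be replayed with `δ` added.

Both substituting a value for a variable and enlarging the qualifier of a variable are instances of
one lemma, which replaces `x : T^p₀` by a term of qualifier `P` with `P ∩ φ ⊆ p₀ ∪ {x}`. For
`(λ x. t) v` and `let x = v in t`, `P` is the closed qualifier of `v`. For a step inside `t₁` of
`let x = t₁ in t₂`, `x` is replaced by itself with `P = δ ∪ {x}`: the qualifier of `x` grows from
`p₀` to `p₀ ∪ δ`, and every qualifier that mentions `x` has to mention `δ` as well.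

The rules for `ref` and `:=` require the content to have type `B^∅`, but a step inside the content
only yields `B^δ`. Pruning repairs this: a term of base type never needs function- or
reference-typed atoms in its qualifier, so `δ` can be removed again.
-/

namespace LStar

universe u v

variable {K : Type u} {C : K → Type v}

/-! ### Substitution in qualifiers, types and terms -/

/-- Replacement of the atom `a` by the qualifier `p`. Substitution for the bound variable with index
`k` is the instance `a = .bvar k`. -/
def Qual.replace (a : Atom) (p q : Qual) : Qual :=
  if a ∈ q then q.erase a ∪ p else q

/-- Qualifier substitution for the free variable `x`. -/
abbrev Qual.subst (x : ℕ) (p q : Qual) : Qual := Qual.replace (.fvar x) p q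

/-- Homomorphic extension of `Qual.subst` to types. -/
def Ty.subst (x : ℕ) (p : Qual) : Ty K → Ty K
  | .base B => .base B
  | .fn T q ε U r =>
      .fn (T.subst x p) (Qual.subst x p q) (Qual.subst x p ε) (U.subst x p) (Qual.subst x p r)
  | .ref B => .ref B

/-- Term substitution for the free variable `x`; capture-avoiding only for locally closed `s`. -/
def Term.subst (t : Term C) (x : ℕ) (s : Term C) : Term C :=
  match t with
  | .const c => .const c
  | .bvar i => .bvar i
  | .fvar y => if y = x then s else .fvar y
  | .loc l => .loc l
  | .lam t => .lam (t.subst x s)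
  | .app t₁ t₂ => .app (t₁.subst x s) (t₂.subst x s)
  | .ref t₁ t₂ => .ref (t₁.subst x s) (t₂.subst x s)
  | .deref t => .deref (t.subst x s)
  | .assign t₁ t₂ => .assign (t₁.subst x s) (t₂.subst x s)
  | .letin t₁ t₂ => .letin (t₁.subst x s) (t₂.subst x s)

namespace Qual

section Replace

variable {a b : Atom} {p p' q q' D : Qual}

theorem mem_replace : b ∈ replace a p q ↔ (b ∈ q ∧ b ≠ a) ∨ (a ∈ q ∧ b ∈ p) := by
  unfold replace
  split_ifs <;> grind

theorem replace_mono (hp : p ⊆ p') (hq : q ⊆ q') : replace a p q ⊆ replace a p' q' := by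
  intro b
  simp only [mem_replace]
  grind

theorem replace_of_notMem (h : a ∉ q) : replace a p q = q :=
  if_neg h

theorem replace_subset (hq : q ⊆ D ∪ {a}) (hp : p ⊆ D) : replace a p q ⊆ D := by
  intro b hb
  rcases mem_replace.1 hb with ⟨hb, hne⟩ | ⟨_, hb⟩
  · exact (Finset.mem_union.1 (hq hb)).resolve_right (by simpa using hne)
  · exact hp hb

end Replace

variable {D D' p p' q q' : Qual} {k k' x y : ℕ}

theorem mem_inst {a : Atom} :
    a ∈ inst k p q ↔ (a ∈ q ∧ a ≠ .bvar k) ∨ (Atom.bvar k ∈ q ∧ a ∈ p) :=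
  mem_replace

theorem inst_of_notMem (h : Atom.bvar k ∉ q) : inst k p q = q :=
  replace_of_notMem h

theorem inst_subset (hq : q ⊆ D ∪ {.bvar k}) (hp : p ⊆ D) : inst k p q ⊆ D :=
  replace_subset hq hp

theorem subst_mono (h : q ⊆ q') : subst x p q ⊆ subst x p q' :=
  replace_mono subset_rfl h

theorem subst_union : subst x p (q ∪ q') = subst x p q ∪ subst x p q' := by
  ext a
  simp only [mem_replace, Finset.mem_union]
  grind

theorem subst_singleton_of_ne {a : Atom} (ha : a ≠ .fvar x) : subst x p {a} = {a} :=
  replace_of_notMem (by simpa using ha.symm)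

theorem subst_inst (hp : ∀ i, Atom.bvar i ∉ p) :
    subst x p (inst k p' q) = inst k (subst x p p') (subst x p q) := by
  ext a
  have := hp k
  simp only [mem_replace, mem_inst]
  grind

theorem subst_inst_fvar (hp : ∀ i, Atom.bvar i ∉ p) (hxy : y ≠ x) :
    subst x p (inst k {.fvar y} q) = inst k {.fvar y} (subst x p q) := by
  rw [subst_inst hp, subst_singleton_of_ne (by simpa using hxy)]

theorem subst_inst_fvar_self (hx : Atom.fvar x ∉ q) :
    subst x p (inst k {.fvar x} q) = inst k p q := by
  ext a
  simp only [mem_replace, mem_inst, Finset.mem_singleton]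
  grind

theorem scoped_zero : Scoped D 0 q ↔ q ⊆ D := by
  simp [Scoped, Finset.subset_iff]

namespace Scoped

theorem mono (hD : D ⊆ D') (hk : k ≤ k') (h : Scoped D k q) : Scoped D' k' q := by
  intro a ha
  rcases h a ha with h | ⟨i, hi, h⟩
  · exact .inl (hD h)
  · exact .inr ⟨i, hi.trans_le hk, h⟩

theorem inst (h : Scoped D (k + 1) q) (hp : p ⊆ D) : Scoped D k (Qual.inst k p q) := by
  intro a ha
  rcases mem_inst.1 ha with ⟨ha, hak⟩ | ⟨_, ha⟩
  · rcases h a ha with h | ⟨i, hi, rfl⟩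
    · exact .inl h
    · exact .inr ⟨i, by grind, rfl⟩
  · exact .inl (hp ha)

theorem named (h : Scoped D 1 q) : Qual.named x q ⊆ D ∪ {.fvar x} :=
  scoped_zero.1 ((h.mono Finset.subset_union_left le_rfl).inst Finset.subset_union_right)

theorem subst (h : Scoped D k q) (hp : p ⊆ D') (hD : D.erase (.fvar x) ⊆ D') :
    Scoped D' k (Qual.subst x p q) := by
  intro a ha
  rcases mem_replace.1 ha with ⟨ha, hax⟩ | ⟨_, ha⟩
  · exact (h a ha).imp_left fun h => hD (Finset.mem_erase.2 ⟨hax, h⟩)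
  · exact .inl (hp ha)

theorem of_inst_fvar (L : Finset ℕ)
    (h : ∀ x ∉ L, Scoped (D ∪ {.fvar x}) k (Qual.inst k {.fvar x} q)) : Scoped D (k + 1) q := by
  intro a ha
  by_cases hak : a = .bvar k
  · exact .inr ⟨k, k.lt_succ_self, hak⟩
  · obtain ⟨x, hx⟩ := Infinite.exists_notMem_finset
      (L ∪ a.casesOn (fun _ => ∅) (fun y => {y}) (fun _ => ∅))
    have hax : a ≠ .fvar x := by
      rintro rfl
      simp at hx
    rcases h x (by grind) a (mem_inst.2 (.inl ⟨ha, hak⟩)) with h | ⟨i, hi, h⟩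
    · exact .inl ((Finset.mem_union.1 h).resolve_right (by simpa using hax))
    · exact .inr ⟨i, hi.trans k.lt_succ_self, h⟩

theorem fvar_notMem (h : Scoped D k q) (hx : Atom.fvar x ∉ D) : Atom.fvar x ∉ q := by
  intro hq
  rcases h _ hq with h | ⟨_, _, h⟩
  · exact hx h
  · cases h

theorem subst_eq (h : Scoped D k q) (hx : Atom.fvar x ∉ D) : Qual.subst x p q = q :=
  replace_of_notMem (h.fvar_notMem hx)

end Scoped

end Qual

namespace Ty

variable {D D' p p' : Qual} {T : Ty K} {j k k' x y : ℕ}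

theorem NotFree.inst_eq (h : T.NotFree k) : T.inst k p = T := by
  induction T generalizing k with
  | fn T q ε U r ihT ihU =>
    obtain ⟨hT, hq, hε, hU, hr⟩ := h
    simp only [Ty.inst, ihT hT, ihU hU, Qual.inst_of_notMem hq, Qual.inst_of_notMem hε,
      Qual.inst_of_notMem hr]
  | _ => rfl

theorem NotFree.subst (h : T.NotFree k) (hp : ∀ i, Atom.bvar i ∉ p) :
    (T.subst x p).NotFree k := by
  have notMem {k : ℕ} {q : Qual} (hq : Atom.bvar k ∉ q) : Atom.bvar k ∉ Qual.subst x p q := by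
    have := hp k
    grind [Qual.mem_replace]
  induction T generalizing k with
  | fn T q ε U r ihT ihU =>
    obtain ⟨hT, hq, hε, hU, hr⟩ := h
    exact ⟨ihT hT, notMem hq, notMem hε, ihU hU, notMem hr⟩
  | _ => trivial

theorem subst_inst (hp : ∀ i, Atom.bvar i ∉ p) :
    (T.inst k p').subst x p = (T.subst x p).inst k (Qual.subst x p p') := by
  induction T generalizing k with
  | fn T q ε U r ihT ihU => simp only [Ty.subst, Ty.inst, ihT, ihU, Qual.subst_inst hp]
  | _ => rfl

theorem subst_inst_fvar (hp : ∀ i, Atom.bvar i ∉ p) (hxy : y ≠ x) :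
    (T.inst k {.fvar y}).subst x p = (T.subst x p).inst k {.fvar y} := by
  rw [subst_inst hp, Qual.subst_singleton_of_ne (by simpa using hxy)]

namespace Scoped

theorem mono (hD : D ⊆ D') (hk : k ≤ k') (h : T.Scoped D k) : T.Scoped D' k' := by
  induction T generalizing k k' with
  | fn T q ε U r ihT ihU =>
    obtain ⟨hT, hq, hε, hU, hr⟩ := h
    have hk' := Nat.succ_le_succ hk
    exact ⟨ihT hk hT, hq.mono hD hk, hε.mono hD hk', ihU hk' hU, hr.mono hD hk'⟩
  | _ => trivial

theorem inst (h : T.Scoped D (k + 1)) (hp : p ⊆ D) : (T.inst k p).Scoped D k := by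
  induction T generalizing k with
  | fn T q ε U r ihT ihU =>
    obtain ⟨hT, hq, hε, hU, hr⟩ := h
    exact ⟨ihT hT, hq.inst hp, hε.inst hp, ihU hU, hr.inst hp⟩
  | _ => trivial

theorem named (h : T.Scoped D 1) : (T.named x).Scoped (D ∪ {.fvar x}) 0 :=
  (h.mono Finset.subset_union_left le_rfl).inst Finset.subset_union_right

theorem subst (h : T.Scoped D k) (hp : p ⊆ D') (hD : D.erase (.fvar x) ⊆ D') :
    (T.subst x p).Scoped D' k := by
  induction T generalizing k with
  | fn T q ε U r ihT ihU =>
    obtain ⟨hT, hq, hε, hU, hr⟩ := h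
    exact ⟨ihT hT, hq.subst hp hD, hε.subst hp hD, ihU hU, hr.subst hp hD⟩
  | _ => trivial

theorem of_inst_fvar (L : Finset ℕ)
    (h : ∀ x ∉ L, (T.inst k {.fvar x}).Scoped (D ∪ {.fvar x}) k) : T.Scoped D (k + 1) := by
  induction T generalizing k with
  | fn T q ε U r ihT ihU =>
    exact ⟨ihT fun x hx => (h x hx).1, .of_inst_fvar L fun x hx => (h x hx).2.1,
      .of_inst_fvar L fun x hx => (h x hx).2.2.1, ihU fun x hx => (h x hx).2.2.2.1,
      .of_inst_fvar L fun x hx => (h x hx).2.2.2.2⟩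
  | _ => trivial

theorem subst_eq (h : T.Scoped D k) (hx : Atom.fvar x ∉ D) : T.subst x p = T := by
  induction T generalizing k with
  | fn T q ε U r ihT ihU =>
    obtain ⟨hT, hq, hε, hU, hr⟩ := h
    simp only [Ty.subst, ihT hT, hq.subst_eq hx, hε.subst_eq hx, ihU hU, hr.subst_eq hx]
  | _ => rfl

theorem subst_inst_fvar_self (h : T.Scoped D j) (hx : Atom.fvar x ∉ D) :
    (T.inst k {.fvar x}).subst x p = T.inst k p := by
  induction T generalizing k j with
  | fn T q ε U r ihT ihU =>
    obtain ⟨hT, hq, hε, hU, hr⟩ := h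
    simp only [Ty.subst, Ty.inst, ihT hT, ihU hU, Qual.subst_inst_fvar_self (hq.fvar_notMem hx),
      Qual.subst_inst_fvar_self (hε.fvar_notMem hx), Qual.subst_inst_fvar_self (hr.fvar_notMem hx)]
  | _ => rfl

end Scoped

/-- The type is not a function type. -/
def Simple : Ty K → Prop
  | .fn .. => False
  | _ => True

theorem Simple.scoped (h : T.Simple) (D : Qual) (k : ℕ) : T.Scoped D k := by
  cases T <;> trivial

end Ty

namespace Term

variable {s s' t : Term C} {i j k x y : ℕ}

/-- Local closure: no bound variable of the term is dangling, so opening it has no effect. -/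
def LC (t : Term C) : Prop := ∀ k s, t.inst k s = t

theorem inst_eq_of_inst_inst (hij : i ≠ j) (h : (t.inst j s').inst i s = t.inst j s') :
    t.inst i s = t := by
  induction t generalizing i j with
  | bvar m =>
    by_cases hm : m = j
    · simp [Term.inst, hm, hij.symm]
    · simpa [Term.inst, hm] using h
  | const | fvar | loc => rfl
  | _ => grind [Term.inst]

theorem subst_inst_fvar (hs : s.LC) (hxy : y ≠ x) :
    (t.inst k (.fvar y)).subst x s = (t.subst x s).inst k (.fvar y) := by
  induction t generalizing k with
  | bvar i =>
    simp only [Term.inst, Term.subst]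
    split_ifs <;> simp [Term.subst, hxy]
  | fvar z =>
    simp only [Term.inst, Term.subst]
    split_ifs
    · exact (hs _ _).symm
    · rfl
  | _ => simp_all [Term.inst, Term.subst]

/-- The free variables of a term. -/
def fv : Term C → Finset ℕ
  | .const _ => ∅
  | .bvar _ => ∅
  | .fvar x => {x}
  | .loc _ => ∅
  | .lam t => t.fv
  | .app t₁ t₂ => t₁.fv ∪ t₂.fv
  | .ref t₁ t₂ => t₁.fv ∪ t₂.fv
  | .deref t => t.fv
  | .assign t₁ t₂ => t₁.fv ∪ t₂.fv
  | .letin t₁ t₂ => t₁.fv ∪ t₂.fv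

theorem subst_inst_fvar_self (hx : x ∉ t.fv) : (t.inst k (.fvar x)).subst x s = t.inst k s := by
  induction t generalizing k with
  | bvar i =>
    simp only [Term.inst]
    split_ifs <;> simp [Term.subst]
  | fvar z =>
    have : z ≠ x := fun h => hx (by simp [fv, h])
    simp [Term.inst, Term.subst, this]
  | _ => simp_all [Term.inst, Term.subst, fv]

theorem subst_fvar_self : t.subst x (.fvar x) = t := by
  induction t with
  | fvar z => grind [Term.subst]
  | _ => simp_all [Term.subst]

end Term

theorem HasType.lc {Γ : Ctx K} {Ψ : StoreTy K} {φ : Qual} {t : Term C} {T : Ty K} {q ε : Qual}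
    (h : HasType Γ Ψ φ t T q ε) : t.LC := by
  induction h with
  | cst | var | loc => exact fun _ _ => rfl
  | abs L _ _ _ _ ih =>
    intro k s
    obtain ⟨x, hx⟩ := Infinite.exists_notMem_finset L
    rw [Term.inst, Term.inst_eq_of_inst_inst (Nat.succ_ne_zero k) (ih x hx _ _)]
  | letin L _ _ _ ih₁ ih₂ =>
    intro k s
    obtain ⟨x, hx⟩ := Infinite.exists_notMem_finset L
    rw [Term.inst, ih₁, Term.inst_eq_of_inst_inst (Nat.succ_ne_zero k) (ih₂ x hx _ _)]
  | app _ _ _ _ _ _ _ ih₁ ih₂ | ref _ _ ih₁ ih₂ | assign _ _ ih₁ ih₂ =>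
    intro k s
    rw [Term.inst, ih₁, ih₂]
  | deref _ ih =>
    intro k s
    rw [Term.inst, ih]
  | sub _ _ _ _ ih => exact ih

/-! ### Domains and well-formed contexts -/

/-- The joint domain of a typing environment and a store typing. -/
abbrev dom (Γ : Ctx K) (Ψ : StoreTy K) : Qual := domC Γ ∪ domS Ψ

/-- The variables bound by a typing environment. -/
def names (Γ : Ctx K) : Finset ℕ := (Γ.map Prod.fst).toFinset

/-- Well-formedness of a typing context with its observation: `Γ` and `φ` are well-scoped, and, as
in the store typings of well-formed stores, the locations in `Ψ` have first-order types with empty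
qualifiers. -/
structure WF (Γ : Ctx K) (Ψ : StoreTy K) (φ : Qual) : Prop where
  ty {x : ℕ} {T : Ty K} {q : Qual} : (x, T, q) ∈ Γ → T.Scoped (dom Γ Ψ) 0
  qual {x : ℕ} {T : Ty K} {q : Qual} : (x, T, q) ∈ Γ → q ⊆ dom Γ Ψ
  simple {l : ℕ} {T : Ty K} {q : Qual} : (l, T, q) ∈ Ψ → T.Simple
  flat {l : ℕ} {T : Ty K} {q : Qual} : (l, T, q) ∈ Ψ → q = ∅
  obs : φ ⊆ dom Γ Ψ

section Contexts

variable {Γ Γ' : Ctx K} {Ψ Ψ' : StoreTy K} {φ ψ q : Qual} {T : Ty K} {x y l : ℕ} {a : Atom}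

theorem mem_domC : a ∈ domC Γ ↔ ∃ e ∈ Γ, a = .fvar e.1 := by
  simp [domC, eq_comm]

theorem mem_domS : a ∈ domS Ψ ↔ ∃ e ∈ Ψ, a = .loc e.1 := by
  simp [domS, eq_comm]

theorem mem_names : x ∈ names Γ ↔ ∃ e ∈ Γ, e.1 = x := by
  simp [names]

theorem notMem_names_cons {e : Ty K × Qual} (hx : x ∉ names Γ) (hyx : y ≠ x) :
    x ∉ names ((y, e) :: Γ) := by
  simp_all [names, eq_comm]

theorem mem_domC_of_mem (h : (x, T, q) ∈ Γ) : Atom.fvar x ∈ domC Γ :=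
  mem_domC.2 ⟨_, h, rfl⟩

theorem mem_domS_of_mem (h : (l, T, q) ∈ Ψ) : Atom.loc l ∈ domS Ψ :=
  mem_domS.2 ⟨_, h, rfl⟩

theorem domS_cons {e : ℕ × Ty K × Qual} : domS (e :: Ψ) = insert (.loc e.1) (domS Ψ) := by
  simp [domS]

theorem dom_nil : dom ([] : Ctx K) Ψ = domS Ψ :=
  Finset.empty_union _

theorem dom_cons {e : Ty K × Qual} : dom ((x, e) :: Γ) Ψ = dom Γ Ψ ∪ {.fvar x} := by
  ext a
  simp only [domC, List.map_cons, List.toFinset_cons, Finset.mem_union, Finset.mem_insert,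
    Finset.mem_singleton]
  tauto

theorem dom_subset_dom_cons {e : Ty K × Qual} : dom Γ Ψ ⊆ dom ((x, e) :: Γ) Ψ :=
  Finset.subset_union_left.trans dom_cons.superset

theorem dom_cons_subset {e e' : Ty K × Qual} (hd : dom Γ Ψ ⊆ dom Γ' Ψ') :
    dom ((x, e) :: Γ) Ψ ⊆ dom ((x, e') :: Γ') Ψ' := by
  rw [dom_cons, dom_cons]
  exact Finset.union_subset_union_left hd

theorem bvar_notMem_dom (i : ℕ) : Atom.bvar i ∉ dom Γ Ψ := by
  simp [mem_domC, mem_domS]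

theorem bvar_notMem_of_subset_dom (hq : q ⊆ dom Γ Ψ) (i : ℕ) : Atom.bvar i ∉ q :=
  fun hi => bvar_notMem_dom i (hq hi)

theorem fvar_mem_dom : Atom.fvar x ∈ dom Γ Ψ ↔ x ∈ names Γ := by
  simp only [Finset.mem_union, mem_domC, mem_domS, mem_names]
  grind

theorem fvar_notMem_domS : Atom.fvar x ∉ domS Ψ := by
  simp [mem_domS]

namespace WF

theorem cons (wf : WF Γ Ψ φ) (hψ : ψ ⊆ φ) (hT : T.Scoped (dom Γ Ψ) 0) (hq : q ⊆ dom Γ Ψ) :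
    WF ((x, T, q) :: Γ) Ψ (ψ ∪ {.fvar x}) where
  ty h := by
    rcases List.mem_cons.1 h with h | h
    · cases h
      exact hT.mono dom_subset_dom_cons le_rfl
    · exact (wf.ty h).mono dom_subset_dom_cons le_rfl
  qual h := by
    rcases List.mem_cons.1 h with h | h
    · cases h
      exact hq.trans dom_subset_dom_cons
    · exact (wf.qual h).trans dom_subset_dom_cons
  simple := wf.simple
  flat := wf.flat
  obs := (Finset.union_subset_union_left (hψ.trans wf.obs)).trans dom_cons.superset

theorem of_subset (wf : WF Γ Ψ φ) (hψ : ψ ⊆ dom Γ Ψ) : WF Γ Ψ ψ :=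
  ⟨wf.ty, wf.qual, wf.simple, wf.flat, hψ⟩

end WF

end Contexts

/-! ### Saturation -/

section Saturation

variable {Γ : Ctx K} {Ψ : StoreTy K} {φ p q X : Qual} {a b : Atom}

theorem subset_sat : q ⊆ sat Γ Ψ q :=
  fun a ha => mem_sat.2 ⟨a, ha, .refl⟩

theorem sat_mono (h : p ⊆ q) : sat Γ Ψ p ⊆ sat Γ Ψ q := by
  intro a ha
  obtain ⟨b, hb, hba⟩ := mem_sat.1 ha
  exact mem_sat.2 ⟨b, h hb, hba⟩

theorem mem_sat_of_reach (ha : a ∈ sat Γ Ψ q) (h : Reach Γ Ψ a b) : b ∈ sat Γ Ψ q := by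
  obtain ⟨c, hc, hca⟩ := mem_sat.1 ha
  exact mem_sat.2 ⟨c, hc, hca.tail h⟩

theorem sat_subset_of_closed (hq : q ⊆ X) (hX : ∀ a ∈ X, ∀ b, Reach Γ Ψ a b → b ∈ X) :
    sat Γ Ψ q ⊆ X := by
  intro b hb
  obtain ⟨a, ha, hab⟩ := mem_sat.1 hb
  clear hb
  induction hab with
  | refl => exact hq ha
  | tail _ hbc ih => exact hX _ ih _ hbc

theorem WF.mem_dom_of_reach (wf : WF Γ Ψ φ) (h : Reach Γ Ψ a b) : b ∈ dom Γ Ψ := by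
  cases h with
  | var hm hb => exact wf.qual hm hb
  | loc hm hb => simp [wf.flat hm] at hb

theorem WF.sat_subset_dom (wf : WF Γ Ψ φ) (hq : q ⊆ φ) : sat Γ Ψ q ⊆ dom Γ Ψ :=
  sat_subset_of_closed (hq.trans wf.obs) fun _ _ _ h => wf.mem_dom_of_reach h

theorem WF.inter_sat_subset_dom (wf : WF Γ Ψ φ) : sat Γ Ψ p ∩ sat Γ Ψ φ ⊆ dom Γ Ψ :=
  Finset.inter_subset_right.trans (wf.sat_subset_dom subset_rfl)

theorem WF.sat_nil (wf : WF [] Ψ φ) : sat [] Ψ q = q := by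
  refine (sat_subset_of_closed subset_rfl fun a _ b h => ?_).antisymm subset_sat
  cases h with
  | var hm _ => simp at hm
  | loc hm hb => simp [wf.flat hm] at hb

end Saturation

/-! ### Subtyping -/

section Subtyping

variable {Γ Γ' : Ctx K} {Ψ Ψ' : StoreTy K} {S T U V : Ty K}
  {P o o' p q r ε ε₁ ε₂ ε₃ : Qual} {x : ℕ}

theorem QSub.mono (hd : dom Γ Ψ ⊆ dom Γ' Ψ') (h : QSub Γ Ψ p q) : QSub Γ' Ψ' p q :=
  ⟨h.1, h.2.trans hd⟩

theorem QSub.refl_named {e : Ty K × Qual} (hq : Qual.Scoped (dom Γ Ψ) 1 q) :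
    QSub ((x, e) :: Γ) Ψ (q.named x) (q.named x) :=
  ⟨subset_rfl, hq.named.trans dom_cons.superset⟩

theorem QSub.trans (h : QSub Γ Ψ p q) (h' : QSub Γ Ψ q r) : QSub Γ Ψ p r :=
  ⟨h.1.trans h'.1, h'.2⟩

theorem QSub.scoped_of_named {e : Ty K × Qual} (L : Finset ℕ)
    (h : ∀ x ∉ L, QSub ((x, e) :: Γ) Ψ (p.named x) (q.named x)) :
    Qual.Scoped (dom Γ Ψ) 1 p ∧ Qual.Scoped (dom Γ Ψ) 1 q :=
  ⟨.of_inst_fvar L fun x hx =>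
      Qual.scoped_zero.2 (((h x hx).1.trans (h x hx).2).trans dom_cons.subset),
    .of_inst_fvar L fun x hx => Qual.scoped_zero.2 ((h x hx).2.trans dom_cons.subset)⟩

theorem QSub.subst (hP : P ⊆ dom Γ' Ψ) (hd : (dom Γ Ψ).erase (.fvar x) ⊆ dom Γ' Ψ)
    (h : QSub Γ Ψ p q) : QSub Γ' Ψ (Qual.subst x P p) (Qual.subst x P q) :=
  ⟨Qual.subst_mono h.1,
    Qual.scoped_zero.1 (.subst (Qual.scoped_zero.2 h.2) hP hd)⟩

theorem TSub.mono (hd : dom Γ Ψ ⊆ dom Γ' Ψ') (h : TSub Γ Ψ S T) : TSub Γ' Ψ' S T := by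
  induction h generalizing Γ' Ψ' with
  | base => exact .base _
  | ref => exact .ref _
  | fn L _ hpo _ hqr hε ihUS ihTV =>
    exact .fn L (ihUS hd) (hpo.mono hd) (fun x hx => ihTV x hx (dom_cons_subset hd))
      (fun x hx => (hqr x hx).mono (dom_cons_subset hd))
      (fun x hx => (hε x hx).mono (dom_cons_subset hd))

theorem TSub.scoped (h : TSub Γ Ψ S T) : S.Scoped (dom Γ Ψ) 0 ∧ T.Scoped (dom Γ Ψ) 0 := by
  induction h with
  | base | ref => exact ⟨trivial, trivial⟩
  | fn L _ hpo _ hqr hε ihUS ihTV =>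
    obtain ⟨hq, hr⟩ := QSub.scoped_of_named L hqr
    obtain ⟨hε₁, hε₂⟩ := QSub.scoped_of_named L hε
    exact ⟨⟨ihUS.2, Qual.scoped_zero.2 hpo.2, hε₁,
        .of_inst_fvar L fun x hx => (ihTV x hx).1.mono dom_cons.subset le_rfl, hq⟩,
      ⟨ihUS.1, Qual.scoped_zero.2 (hpo.1.trans hpo.2), hε₂,
        .of_inst_fvar L fun x hx => (ihTV x hx).2.mono dom_cons.subset le_rfl, hr⟩⟩

/-- The height of a type; it is invariant under naming the bound variable of a function type, where
structural recursion on types does not apply. -/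
def Ty.height : Ty K → ℕ
  | .fn T _ _ U _ => max T.height U.height + 1
  | _ => 0

theorem Ty.height_inst {k : ℕ} : (T.inst k p).height = T.height := by
  induction T generalizing k with
  | fn T q ε U r ihT ihU => simp only [Ty.inst, Ty.height, ihT, ihU]
  | _ => rfl

theorem TSub.refl (h : T.Scoped (dom Γ Ψ) 0) : TSub Γ Ψ T T := by
  induction hn : T.height using Nat.strong_induction_on generalizing T Γ with
  | _ n ih =>
    cases T with
    | base => exact .base _
    | ref => exact .ref _
    | fn T q ε U r =>
      obtain ⟨hT, hq, hε, hU, hr⟩ := h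
      have hTn : T.height < n := by grind [Ty.height]
      have hUn {x : ℕ} : (U.named x).height < n := by grind [Ty.height, Ty.height_inst]
      exact .fn ∅ (ih _ hTn hT rfl) ⟨subset_rfl, Qual.scoped_zero.1 hq⟩
        (fun x _ => ih _ hUn (hU.named.mono dom_cons.superset le_rfl) rfl)
        (fun x _ => .refl_named hr) (fun x _ => .refl_named hε)

theorem TSub.fn_of_subset (h : (Ty.fn T o ε U r).Scoped (dom Γ Ψ) 0) (ho : o' ⊆ o) :
    TSub Γ Ψ (.fn T o ε U r) (.fn T o' ε U r) := by
  obtain ⟨hT, ho₀, hε, hU, hr⟩ := h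
  exact .fn ∅ (.refl hT) ⟨ho, Qual.scoped_zero.1 ho₀⟩
    (fun x _ => .refl (hU.named.mono dom_cons.superset le_rfl))
    (fun x _ => .refl_named hr) (fun x _ => .refl_named hε)

theorem TSub.trans (h : TSub Γ Ψ S T) (h' : TSub Γ Ψ T U) : TSub Γ Ψ S U := by
  induction hn : T.height using Nat.strong_induction_on generalizing Γ S T U with
  | _ n ih =>
    cases h with
    | base => exact h'
    | ref => exact h'
    | @fn _ _ S₁ T₁ S₂ T₂ o p q r ε₁ ε₂ L hS hpo hT hqr hε =>
      cases h' with
      | @fn _ _ _ _ S₃ T₃ _ p' _ r' _ ε₃ L' hS' hpo' hT' hqr' hε' =>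
        have hS₂ : S₂.height < n := by grind [Ty.height]
        have hT₂ {x : ℕ} : (T₂.named x).height < n := by grind [Ty.height, Ty.height_inst]
        have hd {x : ℕ} : dom ((x, S₂, p) :: Γ) Ψ ⊆ dom ((x, S₃, p') :: Γ) Ψ :=
          dom_cons_subset subset_rfl
        refine .fn (L ∪ L') (ih _ hS₂ hS' hS rfl) (hpo'.trans hpo) (fun x hx => ?_)
          (fun x hx => ?_) (fun x hx => ?_) <;> rw [Finset.mem_union, not_or] at hx
        · exact ih _ hT₂ ((hT x hx.1).mono hd) (hT' x hx.2) rfl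
        · exact ((hqr x hx.1).mono hd).trans (hqr' x hx.2)
        · exact ((hε x hx.1).mono hd).trans (hε' x hx.2)

theorem erase_dom_cons_subset {y : ℕ} {e e' : Ty K × Qual}
    (hd : (dom Γ Ψ).erase (.fvar x) ⊆ dom Γ' Ψ') :
    (dom ((y, e) :: Γ) Ψ).erase (.fvar x) ⊆ dom ((y, e') :: Γ') Ψ' := by
  rw [dom_cons, dom_cons, Finset.erase_union_distrib]
  exact Finset.union_subset_union hd (Finset.erase_subset _ _)

theorem TSub.subst (hP : P ⊆ dom Γ' Ψ) (hd : (dom Γ Ψ).erase (.fvar x) ⊆ dom Γ' Ψ)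
    (h : TSub Γ Ψ S T) : TSub Γ' Ψ (S.subst x P) (T.subst x P) := by
  induction h generalizing Γ' with
  | base => exact .base _
  | ref => exact .ref _
  | @fn Γ Ψ S T U V o p q r ε₁ ε₂ L _ hpo _ hqr hε ihUS ihTV =>
    have hPb := bvar_notMem_of_subset_dom hP
    have hP' {y : ℕ} : P ⊆ dom ((y, U.subst x P, Qual.subst x P p) :: Γ') Ψ :=
      hP.trans dom_subset_dom_cons
    refine .fn (insert x L) (ihUS hP hd) (hpo.subst hP hd) (fun y hy => ?_) (fun y hy => ?_)
      (fun y hy => ?_) <;> rw [Finset.mem_insert, not_or] at hy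
    · simpa only [Ty.subst_inst_fvar hPb hy.1] using
        ihTV y hy.2 hP' (erase_dom_cons_subset hd)
    · simpa only [Qual.subst_inst_fvar hPb hy.1] using
        (hqr y hy.2).subst hP' (erase_dom_cons_subset hd)
    · simpa only [Qual.subst_inst_fvar hPb hy.1] using
        (hε y hy.2).subst hP' (erase_dom_cons_subset hd)

namespace QTSub

theorem mono (hd : dom Γ Ψ ⊆ dom Γ' Ψ') (h : QTSub Γ Ψ S p ε₁ T q ε₂) :
    QTSub Γ' Ψ' S p ε₁ T q ε₂ :=
  ⟨h.1.mono hd, h.2.1.mono hd, h.2.2.mono hd⟩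

theorem trans (h : QTSub Γ Ψ S p ε₁ T q ε₂) (h' : QTSub Γ Ψ T q ε₂ U r ε₃) :
    QTSub Γ Ψ S p ε₁ U r ε₃ :=
  ⟨h.1.trans h'.1, h.2.1.trans h'.2.1, h.2.2.trans h'.2.2⟩

theorem subst (hP : P ⊆ dom Γ' Ψ) (hd : (dom Γ Ψ).erase (.fvar x) ⊆ dom Γ' Ψ)
    (h : QTSub Γ Ψ S p ε₁ T q ε₂) :
    QTSub Γ' Ψ (S.subst x P) (Qual.subst x P p) (Qual.subst x P ε₁) (T.subst x P)
      (Qual.subst x P q) (Qual.subst x P ε₂) :=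
  ⟨h.1.subst hP hd, h.2.1.subst hP hd, h.2.2.subst hP hd⟩

end QTSub

end Subtyping

/-! ### Regularity and subsumption -/

section Regularity

variable {Γ : Ctx K} {Ψ : StoreTy K} {φ ψ o p q q' r ε ε' ε₁ ε₂ ε₃ : Qual} {t t₁ t₂ : Term C}
  {T U : Ty K}

theorem scoped_of_forall_named {e : Ty K × Qual} (L : Finset ℕ)
    (h : ∀ x ∉ L, (U.named x).Scoped (dom ((x, e) :: Γ) Ψ) 0 ∧ r.named x ⊆ ψ ∪ {.fvar x} ∧
      ε.named x ⊆ ψ ∪ {.fvar x}) :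
    U.Scoped (dom Γ Ψ) 1 ∧ Qual.Scoped ψ 1 r ∧ Qual.Scoped ψ 1 ε :=
  ⟨.of_inst_fvar L fun x hx => (h x hx).1.mono dom_cons.subset le_rfl,
    .of_inst_fvar L fun x hx => Qual.scoped_zero.2 (h x hx).2.1,
    .of_inst_fvar L fun x hx => Qual.scoped_zero.2 (h x hx).2.2⟩

namespace HasType

theorem regular (h : HasType Γ Ψ φ t T q ε) (wf : WF Γ Ψ φ) :
    T.Scoped (dom Γ Ψ) 0 ∧ q ⊆ φ ∧ ε ⊆ φ := by
  induction h with
  | cst => exact ⟨trivial, by simp, by simp⟩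
  | var hm hx => exact ⟨wf.ty hm, by simpa using hx, by simp⟩
  | loc hm hl => exact ⟨(wf.simple hm).scoped _ _, by simpa using hl, by simp⟩
  | abs L hT hp _ hq ih =>
    obtain ⟨hU, hr, hε⟩ := scoped_of_forall_named L fun x hx => ih x hx (wf.cons hq hT hp)
    have hqd := hq.trans wf.obs
    exact ⟨⟨hT, Qual.scoped_zero.2 hp, hε.mono hqd le_rfl, hU, hr.mono hqd le_rfl⟩, hq, by simp⟩
  | app _ _ _ _ _ hε hr ih₁ ih₂ =>
    obtain ⟨⟨_, _, _, hU, _⟩, hq, hε₁⟩ := ih₁ wf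
    obtain ⟨_, hp, hε₂⟩ := ih₂ wf
    exact ⟨hU.inst (hp.trans wf.obs), Qual.inst_subset hr hp,
      Finset.union_subset (Finset.union_subset hε₁ hε₂)
        (Qual.inst_subset (hε.trans (Finset.union_subset_union_left hq)) hp)⟩
  | letin L _ _ _ ih₁ ih₂ =>
    obtain ⟨hS, hp, hε₁⟩ := ih₁ wf
    obtain ⟨hT, hq, hε₂⟩ := scoped_of_forall_named L fun x hx =>
      ih₂ x hx (wf.cons subset_rfl hS wf.inter_sat_subset_dom)
    exact ⟨hT.inst (hp.trans wf.obs), Qual.scoped_zero.1 (hq.inst hp),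
      Finset.union_subset hε₁ (Qual.scoped_zero.1 (hε₂.inst hp))⟩
  | ref _ _ ih₁ ih₂ | assign _ _ ih₁ ih₂ =>
    exact ⟨trivial, by simp,
      Finset.union_subset (Finset.union_subset (ih₁ wf).2.2 (ih₂ wf).2.2) (ih₁ wf).2.1⟩
  | deref _ ih => exact ⟨trivial, by simp, Finset.union_subset (ih wf).2.2 (ih wf).2.1⟩
  | sub _ hsub hq hε _ => exact ⟨hsub.1.scoped.2, hq, hε⟩

theorem regular_body (L : Finset ℕ)
    (h : ∀ x ∉ L, HasType ((x, T, p) :: Γ) Ψ (ψ ∪ {.fvar x}) (t.named x) (U.named x) (r.named x)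
      (ε.named x))
    (wf : WF Γ Ψ φ) (hψ : ψ ⊆ φ) (hT : T.Scoped (dom Γ Ψ) 0) (hp : p ⊆ dom Γ Ψ) :
    U.Scoped (dom Γ Ψ) 1 ∧ Qual.Scoped ψ 1 r ∧ Qual.Scoped ψ 1 ε :=
  scoped_of_forall_named L fun x hx => (h x hx).regular (wf.cons hψ hT hp)

theorem mono (h : HasType Γ Ψ φ t T q ε) (wf : WF Γ Ψ φ) (hq : q ⊆ q') (hq' : q' ⊆ φ)
    (hε : ε ⊆ ε') (hε' : ε' ⊆ φ) : HasType Γ Ψ φ t T q' ε' :=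
  .sub h ⟨.refl (h.regular wf).1, ⟨hq, hq'.trans wf.obs⟩, ⟨hε, hε'.trans wf.obs⟩⟩ hq' hε'

theorem qtsub_refl (h : HasType Γ Ψ φ t T q ε) (wf : WF Γ Ψ φ) : QTSub Γ Ψ T q ε T q ε :=
  have ⟨hT, hq, hε⟩ := h.regular wf
  ⟨.refl hT, ⟨subset_rfl, hq.trans wf.obs⟩, ⟨subset_rfl, hε.trans wf.obs⟩⟩

theorem app_of_subset (wf : WF Γ Ψ φ) (h₁ : HasType Γ Ψ φ t₁ (.fn T o ε₃ U r) q ε₁)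
    (h₂ : HasType Γ Ψ φ t₂ T p ε₂) (ho : sat Γ Ψ p ∩ sat Γ Ψ q ⊆ o) (hp : sat Γ Ψ p ⊆ φ)
    (hq : sat Γ Ψ q ⊆ φ) (hU : U.NotFree 0) (hε : ε₃ ⊆ q ∪ {.bvar 0}) (hr : r ⊆ φ ∪ {.bvar 0}) :
    HasType Γ Ψ φ (.app t₁ t₂) (U.inst 0 p) (Qual.inst 0 p r)
      (ε₁ ∪ ε₂ ∪ Qual.inst 0 p ε₃) :=
  have ⟨hF, hqφ, hε₁⟩ := h₁.regular wf
  have hsub := QTSub.mono subset_rfl ⟨.fn_of_subset hF ho, (h₁.qtsub_refl wf).2⟩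
  .app (.sub h₁ hsub hqφ hε₁) h₂ hp hq hU hε hr

end HasType

end Regularity

/-! ### Weakening and narrowing -/

theorem Reach.cons {Γ : Ctx K} {Ψ : StoreTy K} {e : ℕ × Ty K × Qual} {a b : Atom}
    (h : Reach Γ Ψ a b) : Reach (e :: Γ) Ψ a b := by
  cases h with
  | var hm hb => exact .var (List.mem_cons_of_mem _ hm) hb
  | loc hm hb => exact .loc hm hb

/-- `Γ', Ψ'` extends and narrows `Γ, Ψ`: it contains the same bindings with possibly different
qualifiers, from which nothing new is reachable. -/
structure Ext (Γ : Ctx K) (Ψ : StoreTy K) (Γ' : Ctx K) (Ψ' : StoreTy K) : Prop where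
  var {x : ℕ} {T : Ty K} {q : Qual} : (x, T, q) ∈ Γ → ∃ q', (x, T, q') ∈ Γ'
  loc {l : ℕ} {T : Ty K} {q : Qual} : (l, T, q) ∈ Ψ → ∃ q', (l, T, q') ∈ Ψ'
  reach {a b : Atom} : a ∈ dom Γ Ψ → Reach Γ' Ψ' a b → Reach Γ Ψ a b

section Weakening

variable {Γ Γ' : Ctx K} {Ψ Ψ' : StoreTy K} {φ φ' o p q q' ε ε₁ ε₂ : Qual} {t t₁ t₂ : Term C}
  {S T : Ty K} {x : ℕ}

namespace Ext

theorem refl : Ext Γ Ψ Γ Ψ :=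
  ⟨fun h => ⟨_, h⟩, fun h => ⟨_, h⟩, fun _ h => h⟩

theorem dom_subset (h : Ext Γ Ψ Γ' Ψ') : dom Γ Ψ ⊆ dom Γ' Ψ' := by
  intro a ha
  rcases Finset.mem_union.1 ha with ha | ha
  · obtain ⟨⟨x, T, q⟩, he, rfl⟩ := mem_domC.1 ha
    obtain ⟨q', he'⟩ := h.var he
    exact Finset.mem_union_left _ (mem_domC_of_mem he')
  · obtain ⟨⟨l, T, q⟩, he, rfl⟩ := mem_domS.1 ha
    obtain ⟨q', he'⟩ := h.loc he
    exact Finset.mem_union_right _ (mem_domS_of_mem he')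

theorem sat_subset (h : Ext Γ Ψ Γ' Ψ') (wf : WF Γ Ψ φ) (hq : q ⊆ φ) :
    sat Γ' Ψ' q ⊆ sat Γ Ψ q :=
  sat_subset_of_closed subset_sat fun _ ha _ hab =>
    mem_sat_of_reach ha (h.reach (wf.sat_subset_dom hq ha) hab)

theorem cons (h : Ext Γ Ψ Γ' Ψ') (hx : x ∉ names Γ') (hq : q' ⊆ q) :
    Ext ((x, T, q) :: Γ) Ψ ((x, T, q') :: Γ') Ψ' := by
  refine ⟨fun hm => ?_, h.loc, fun ha hab => ?_⟩
  · rcases List.mem_cons.1 hm with hm | hm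
    · cases hm
      exact ⟨q', List.mem_cons_self⟩
    · obtain ⟨r, hr⟩ := h.var hm
      exact ⟨r, List.mem_cons_of_mem _ hr⟩
  · rw [dom_cons, Finset.mem_union, Finset.mem_singleton] at ha
    cases hab with
    | var hm hb =>
      rcases List.mem_cons.1 hm with hm | hm
      · cases hm
        exact .var List.mem_cons_self (hq hb)
      · refine (h.reach (ha.resolve_right ?_) (.var hm hb)).cons
        rintro ⟨⟩
        exact hx (mem_names.2 ⟨_, hm, rfl⟩)
    | loc hm hb => exact (h.reach (ha.resolve_right (by simp)) (.loc hm hb)).cons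

end Ext

namespace HasType

theorem weaken (h : HasType Γ Ψ φ t T q ε) (wf : WF Γ Ψ φ) (ext : Ext Γ Ψ Γ' Ψ')
    (wf' : WF Γ' Ψ' φ') (hφ : φ ⊆ φ') : HasType Γ' Ψ' φ' t T q ε := by
  induction h generalizing Γ' φ' with
  | cst c => exact .cst c
  | var hm hx =>
    obtain ⟨q', hm'⟩ := ext.var hm
    exact .var hm' (hφ hx)
  | loc hm hl =>
    obtain ⟨q', hm'⟩ := ext.loc hm
    exact .loc hm' (hφ hl)
  | abs L hT hp _ hq ih =>
    have hT' := hT.mono ext.dom_subset le_rfl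
    have hp' := hp.trans ext.dom_subset
    have hq' := hq.trans hφ
    refine .abs (L ∪ names Γ') hT' hp' (fun x hx => ?_) hq'
    rw [Finset.mem_union, not_or] at hx
    exact ih x hx.1 (wf.cons hq hT hp) (ext.cons hx.2 subset_rfl) (wf'.cons hq' hT' hp') subset_rfl
  | app h₁ h₂ hp hq hU hε hr ih₁ ih₂ =>
    have hp' := ext.sat_subset wf (h₂.regular wf).2.1
    have hq' := ext.sat_subset wf (h₁.regular wf).2.1
    exact .app_of_subset wf' (ih₁ wf ext wf' hφ) (ih₂ wf ext wf' hφ)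
      (Finset.inter_subset_inter hp' hq') ((hp'.trans hp).trans hφ) ((hq'.trans hq).trans hφ)
      hU hε (hr.trans (Finset.union_subset_union_left hφ))
  | letin L h₁ _ hT ih₁ ih₂ =>
    obtain ⟨hS, hp, _⟩ := h₁.regular wf
    have hp' := (ext.sat_subset wf hp).trans (Finset.subset_inter subset_rfl (sat_mono hp))
    refine .letin (L ∪ names Γ') (ih₁ wf ext wf' hφ) (fun x hx => ?_) hT
    rw [Finset.mem_union, not_or] at hx
    exact ih₂ x hx.1 (wf.cons subset_rfl hS wf.inter_sat_subset_dom)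
      (ext.cons hx.2 (Finset.inter_subset_left.trans hp'))
      (wf'.cons subset_rfl (hS.mono ext.dom_subset le_rfl) wf'.inter_sat_subset_dom)
      (Finset.union_subset_union_left hφ)
  | ref _ _ ih₁ ih₂ => exact .ref (ih₁ wf ext wf' hφ) (ih₂ wf ext wf' hφ)
  | deref _ ih => exact .deref (ih wf ext wf' hφ)
  | assign _ _ ih₁ ih₂ => exact .assign (ih₁ wf ext wf' hφ) (ih₂ wf ext wf' hφ)
  | sub _ hsub hq hε ih =>
    exact .sub (ih wf ext wf' hφ) (hsub.mono ext.dom_subset) (hq.trans hφ) (hε.trans hφ)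

theorem letin_of_subset (wf : WF Γ Ψ φ) (L : Finset ℕ) (h₁ : HasType Γ Ψ φ t₁ S p ε₁)
    (hpo : sat Γ Ψ p ⊆ o) (ho : o ⊆ dom Γ Ψ)
    (h₂ : ∀ x ∉ L, HasType ((x, S, o) :: Γ) Ψ (φ ∪ {.fvar x}) (t₂.named x) (T.named x)
      (q.named x) (ε₂.named x))
    (hT : T.NotFree 0) :
    HasType Γ Ψ φ (.letin t₁ t₂) (T.inst 0 p) (Qual.inst 0 p q) (ε₁ ∪ Qual.inst 0 p ε₂) := by
  have hS := (h₁.regular wf).1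
  refine .letin (L ∪ names Γ) h₁ (fun x hx => ?_) hT
  rw [Finset.mem_union, not_or] at hx
  exact (h₂ x hx.1).weaken (wf.cons subset_rfl hS ho)
    (Ext.refl.cons hx.2 (Finset.inter_subset_left.trans hpo))
    (wf.cons subset_rfl hS wf.inter_sat_subset_dom) subset_rfl

end HasType

end Weakening

/-! ### Generation -/

section Generation

variable {Γ : Ctx K} {Ψ : StoreTy K} {φ q ε : Qual} {s t t₁ t₂ : Term C} {T F : Ty K} {l : ℕ}

namespace HasType

theorem value (h : HasType Γ Ψ φ s T q ε) (hs : Value s) (wf : WF Γ Ψ φ) :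
    HasType Γ Ψ q s T q ∅ := by
  induction h with
  | cst c => exact .cst c
  | loc hm _ => exact .loc hm (Finset.mem_singleton_self _)
  | abs L hT hp h _ _ => exact .abs L hT hp h subset_rfl
  | sub _ hsub hq _ ih =>
    have hp := hsub.2.1.1.trans (hq.trans wf.obs)
    exact .sub ((ih hs wf).weaken (wf.of_subset hp) .refl (wf.of_subset hsub.2.1.2) hsub.2.1.1)
      ⟨hsub.1, hsub.2.1, ⟨subset_rfl, Finset.empty_subset _⟩⟩ subset_rfl (Finset.empty_subset _)
  | _ => cases hs

theorem const_of_value {B : Base K} (h : HasType Γ Ψ φ s (.base B) ∅ ε) (hs : Value s) :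
    ∃ c : Const C, s = .const c ∧ c.ty = B := by
  generalize hT : Ty.base B = T at h
  generalize hq : (∅ : Qual) = q at h
  induction h with
  | cst c =>
    cases hT
    exact ⟨c, rfl, rfl⟩
  | loc => exact absurd hq (Finset.singleton_ne_empty _).symm
  | abs => cases hT
  | sub h hsub _ _ ih =>
    subst hT hq
    obtain ⟨hT, hq, _⟩ := hsub
    cases hT
    exact ih hs rfl (Finset.subset_empty.1 hq.1).symm
  | _ => cases hs

theorem loc_inv (h : HasType (C := C) Γ Ψ φ (.loc l) T q ε) (wf : WF Γ Ψ φ) :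
    ∃ S r, (l, S, r) ∈ Ψ ∧ TSub Γ Ψ S T ∧ Atom.loc l ∈ q := by
  generalize ht : Term.loc l = t at h
  induction h with
  | loc hm _ =>
    cases ht
    exact ⟨_, _, hm, .refl ((wf.simple hm).scoped _ _), Finset.mem_singleton_self _⟩
  | sub _ hsub _ _ ih =>
    obtain ⟨S, r, hm, hS, hl⟩ := ih wf ht
    exact ⟨S, r, hm, hS.trans hsub.1, hsub.2.1.1 hl⟩
  | _ => cases ht

theorem lam_inv (h : HasType Γ Ψ φ (.lam t) F q ε) (wf : WF Γ Ψ φ) :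
    ∃ (T U : Ty K) (p r ε' q' : Qual) (L : Finset ℕ),
      T.Scoped (dom Γ Ψ) 0 ∧ p ⊆ dom Γ Ψ ∧
      (∀ x ∉ L, HasType ((x, T, p) :: Γ) Ψ (q' ∪ {.fvar x}) (t.named x) (U.named x) (r.named x)
        (ε'.named x)) ∧
      q' ⊆ q ∧ TSub Γ Ψ (.fn T p ε' U r) F := by
  generalize ht : Term.lam t = t' at h
  induction h with
  | abs L hT hp h hq _ =>
    cases ht
    exact ⟨_, _, _, _, _, _, L, hT, hp, h, subset_rfl, .refl (regular (.abs L hT hp h hq) wf).1⟩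
  | sub _ hsub _ _ ih =>
    obtain ⟨T, U, p, r, ε', q', L, hT, hp, h, hq, hF⟩ := ih wf ht
    exact ⟨T, U, p, r, ε', q', L, hT, hp, h, hq.trans hsub.2.1.1, hF.trans hsub.1⟩
  | _ => cases ht

theorem app_inv (h : HasType Γ Ψ φ (.app t₁ t₂) T q ε) (wf : WF Γ Ψ φ) :
    ∃ (S U : Ty K) (p p₁ r ε₁ ε₂ ε₃ : Qual),
      HasType Γ Ψ φ t₁ (.fn S (sat Γ Ψ p ∩ sat Γ Ψ p₁) ε₃ U r) p₁ ε₁ ∧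
      HasType Γ Ψ φ t₂ S p ε₂ ∧
      sat Γ Ψ p ⊆ φ ∧ sat Γ Ψ p₁ ⊆ φ ∧ U.NotFree 0 ∧ ε₃ ⊆ p₁ ∪ {.bvar 0} ∧ r ⊆ φ ∪ {.bvar 0} ∧
      QTSub Γ Ψ (U.inst 0 p) (Qual.inst 0 p r) (ε₁ ∪ ε₂ ∪ Qual.inst 0 p ε₃) T q ε := by
  generalize ht : Term.app t₁ t₂ = t at h
  induction h with
  | app h₁ h₂ hp hq hU hε hr _ _ =>
    cases ht
    exact ⟨_, _, _, _, _, _, _, _, h₁, h₂, hp, hq, hU, hε, hr,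
      (HasType.app h₁ h₂ hp hq hU hε hr).qtsub_refl wf⟩
  | sub _ hsub _ _ ih =>
    obtain ⟨S, U, p, p₁, r, ε₁, ε₂, ε₃, h₁, h₂, hp, hq, hU, hε, hr, hsub'⟩ := ih wf ht
    exact ⟨S, U, p, p₁, r, ε₁, ε₂, ε₃, h₁, h₂, hp, hq, hU, hε, hr, hsub'.trans hsub⟩
  | _ => cases ht

theorem letin_inv (h : HasType Γ Ψ φ (.letin t₁ t₂) T q ε) (wf : WF Γ Ψ φ) :
    ∃ (S U : Ty K) (p r ε₁ ε₂ : Qual) (L : Finset ℕ),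
      HasType Γ Ψ φ t₁ S p ε₁ ∧
      (∀ x ∉ L, HasType ((x, S, sat Γ Ψ p ∩ sat Γ Ψ φ) :: Γ) Ψ (φ ∪ {.fvar x}) (t₂.named x)
        (U.named x) (r.named x) (ε₂.named x)) ∧
      U.NotFree 0 ∧
      QTSub Γ Ψ (U.inst 0 p) (Qual.inst 0 p r) (ε₁ ∪ Qual.inst 0 p ε₂) T q ε := by
  generalize ht : Term.letin t₁ t₂ = t at h
  induction h with
  | letin L h₁ h₂ hU _ _ =>
    cases ht
    exact ⟨_, _, _, _, _, _, L, h₁, h₂, hU, (HasType.letin L h₁ h₂ hU).qtsub_refl wf⟩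
  | sub _ hsub _ _ ih =>
    obtain ⟨S, U, p, r, ε₁, ε₂, L, h₁, h₂, hU, hsub'⟩ := ih wf ht
    exact ⟨S, U, p, r, ε₁, ε₂, L, h₁, h₂, hU, hsub'.trans hsub⟩
  | _ => cases ht

theorem ref_inv (h : HasType Γ Ψ φ (.ref t₁ t₂) T q ε) (wf : WF Γ Ψ φ) :
    ∃ (B : Base K) (p ε₁ ε₂ : Qual),
      HasType Γ Ψ φ t₁ (.base .alloc) p ε₁ ∧ HasType Γ Ψ φ t₂ (.base B) ∅ ε₂ ∧
      QTSub Γ Ψ (.ref B) ∅ (ε₁ ∪ ε₂ ∪ p) T q ε := by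
  generalize ht : Term.ref t₁ t₂ = t at h
  induction h with
  | ref h₁ h₂ _ _ =>
    cases ht
    exact ⟨_, _, _, _, h₁, h₂, (HasType.ref h₁ h₂).qtsub_refl wf⟩
  | sub _ hsub _ _ ih =>
    obtain ⟨B, p, ε₁, ε₂, h₁, h₂, hsub'⟩ := ih wf ht
    exact ⟨B, p, ε₁, ε₂, h₁, h₂, hsub'.trans hsub⟩
  | _ => cases ht

theorem deref_inv (h : HasType Γ Ψ φ (.deref t) T q ε) (wf : WF Γ Ψ φ) :
    ∃ (B : Base K) (p ε₁ : Qual),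
      HasType Γ Ψ φ t (.ref B) p ε₁ ∧ QTSub Γ Ψ (.base B) ∅ (ε₁ ∪ p) T q ε := by
  generalize ht : Term.deref t = t' at h
  induction h with
  | deref h _ =>
    cases ht
    exact ⟨_, _, _, h, (HasType.deref h).qtsub_refl wf⟩
  | sub _ hsub _ _ ih =>
    obtain ⟨B, p, ε₁, h, hsub'⟩ := ih wf ht
    exact ⟨B, p, ε₁, h, hsub'.trans hsub⟩
  | _ => cases ht

theorem assign_inv (h : HasType Γ Ψ φ (.assign t₁ t₂) T q ε) (wf : WF Γ Ψ φ) :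
    ∃ (B : Base K) (p ε₁ ε₂ : Qual),
      HasType Γ Ψ φ t₁ (.ref B) p ε₁ ∧ HasType Γ Ψ φ t₂ (.base B) ∅ ε₂ ∧
      QTSub Γ Ψ (.base .unit) ∅ (ε₁ ∪ ε₂ ∪ p) T q ε := by
  generalize ht : Term.assign t₁ t₂ = t at h
  induction h with
  | assign h₁ h₂ _ _ =>
    cases ht
    exact ⟨_, _, _, _, h₁, h₂, (HasType.assign h₁ h₂).qtsub_refl wf⟩
  | sub _ hsub _ _ ih =>
    obtain ⟨B, p, ε₁, ε₂, h₁, h₂, hsub'⟩ := ih wf ht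
    exact ⟨B, p, ε₁, ε₂, h₁, h₂, hsub'.trans hsub⟩
  | _ => cases ht

end HasType

end Generation

/-! ### Substitution -/

/-- Substitution of the qualifier `P` for `x` throughout a typing environment. -/
def substCtx (x : ℕ) (P : Qual) (Γ : Ctx K) : Ctx K :=
  Γ.map fun e => (e.1, e.2.1.subst x P, Qual.subst x P e.2.2)

/-- The term `s : T^P` in context `Γt` can be substituted for `x : T^p₀`. The context `Γt` may bind
`x` again, so that `x` can be given a different qualifier by replacing it with itself. -/
structure Replaces (Γt : Ctx K) (Ψ : StoreTy K) (x : ℕ) (T : Ty K) (p₀ P : Qual) (s : Term C) :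
    Prop where
  wf : WF Γt Ψ P
  names_subset : names Γt ⊆ {x}
  typed : HasType Γt Ψ P s T P ∅
  ty_scoped : T.Scoped (domS Ψ) 0
  qual_subset : p₀ ⊆ domS Ψ
  reach {a b : Atom} : a ∈ P → Reach Γt Ψ a b → b ∈ P ∪ p₀

section Substitution

variable {Γt Γ Δ : Ctx K} {Ψ : StoreTy K} {x y : ℕ} {S T U : Ty K}
  {p₀ P φ p q r ε : Qual} {s t : Term C} {a b : Atom}

theorem names_substCtx : names (substCtx x P Γ) = names Γ := by
  simp [names, substCtx, Function.comp_def]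

theorem domC_substCtx : domC (substCtx x P Γ) = domC Γ := by
  simp [domC, substCtx, Function.comp_def]

theorem domC_append {Γ' : Ctx K} : domC (Γ ++ Γ') = domC Γ ∪ domC Γ' := by
  simp [domC]

theorem mem_substCtx_of_mem (h : (y, S, q) ∈ Γ) :
    (y, S.subst x P, Qual.subst x P q) ∈ substCtx x P Γ :=
  List.mem_map.2 ⟨_, h, rfl⟩

theorem exists_mem_of_mem_substCtx (h : (y, S, q) ∈ substCtx x P Γ) :
    ∃ S' q', (y, S', q') ∈ Γ ∧ S = S'.subst x P ∧ q = Qual.subst x P q' := by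
  obtain ⟨⟨y, S', q'⟩, hm, he⟩ := List.mem_map.1 h
  cases he
  exact ⟨S', q', hm, rfl, rfl⟩

theorem dom_subset_dom_append : dom Γt Ψ ⊆ dom (Γ ++ Γt) Ψ := by
  rw [dom, dom, domC_append]
  exact Finset.union_subset_union_left Finset.subset_union_right

theorem erase_dom_append_subset :
    (dom (Γ ++ [(x, T, p₀)]) Ψ).erase (.fvar x) ⊆ dom (substCtx x P Γ ++ Γt) Ψ := by
  intro a
  simp only [Finset.mem_erase, Finset.mem_union, domC_append, domC_substCtx]
  have : a ∈ domC [(x, T, p₀)] ↔ a = .fvar x := by simp [domC]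
  tauto

theorem Qual.subst_subset_union_bvar (h : q ⊆ r ∪ {.bvar 0}) :
    Qual.subst x P q ⊆ Qual.subst x P r ∪ {.bvar 0} := by
  refine (Qual.subst_mono h).trans_eq ?_
  rw [Qual.subst_union, Qual.subst_singleton_of_ne (by simp)]

theorem HasType.named_of_subst_named (hs : s.LC) (hP : ∀ i, Atom.bvar i ∉ P) (hyx : y ≠ x)
    (h : HasType Δ Ψ (Qual.subst x P (φ ∪ {.fvar y})) ((t.named y).subst x s)
      ((U.named y).subst x P) (Qual.subst x P (q.named y)) (Qual.subst x P (ε.named y))) :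
    HasType Δ Ψ (Qual.subst x P φ ∪ {.fvar y}) ((t.subst x s).named y) ((U.subst x P).named y)
      ((Qual.subst x P q).named y) ((Qual.subst x P ε).named y) := by
  rwa [Term.subst_inst_fvar hs hyx, Ty.subst_inst_fvar hP hyx, Qual.subst_inst_fvar hP hyx,
    Qual.subst_inst_fvar hP hyx, Qual.subst_union,
    Qual.subst_singleton_of_ne (by simpa using hyx)] at h

namespace Replaces

theorem bvar_notMem (R : Replaces Γt Ψ x T p₀ P s) (i : ℕ) : Atom.bvar i ∉ P :=
  bvar_notMem_of_subset_dom R.wf.obs i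

theorem eq_of_fvar_mem_dom (R : Replaces Γt Ψ x T p₀ P s) (h : Atom.fvar y ∈ dom Γt Ψ) :
    y = x :=
  Finset.mem_singleton.1 (R.names_subset (fvar_mem_dom.1 h))

theorem subset_dom (R : Replaces Γt Ψ x T p₀ P s) : P ⊆ dom (substCtx x P Γ ++ Γt) Ψ :=
  R.wf.obs.trans dom_subset_dom_append

theorem subst_subset_dom (R : Replaces Γt Ψ x T p₀ P s) (hq : q ⊆ dom (Γ ++ [(x, T, p₀)]) Ψ) :
    Qual.subst x P q ⊆ dom (substCtx x P Γ ++ Γt) Ψ :=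
  Qual.scoped_zero.1 ((Qual.scoped_zero.2 hq).subst R.subset_dom erase_dom_append_subset)

theorem subst_wf (R : Replaces Γt Ψ x T p₀ P s) (wf : WF (Γ ++ [(x, T, p₀)]) Ψ φ) :
    WF (substCtx x P Γ ++ Γt) Ψ (Qual.subst x P φ) where
  ty h := by
    rcases List.mem_append.1 h with h | h
    · obtain ⟨S, q, hm, rfl, rfl⟩ := exists_mem_of_mem_substCtx h
      exact (wf.ty (List.mem_append_left _ hm)).subst R.subset_dom erase_dom_append_subset
    · exact (R.wf.ty h).mono dom_subset_dom_append le_rfl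
  qual h := by
    rcases List.mem_append.1 h with h | h
    · obtain ⟨S, q, hm, rfl, rfl⟩ := exists_mem_of_mem_substCtx h
      exact R.subst_subset_dom (wf.qual (List.mem_append_left _ hm))
    · exact (R.wf.qual h).trans dom_subset_dom_append
  simple := wf.simple
  flat := wf.flat
  obs := R.subst_subset_dom wf.obs

theorem reach_of_append (R : Replaces Γt Ψ x T p₀ P s) (hx : x ∉ names Γ) (ha : a ∈ dom Γt Ψ)
    (h : Reach (substCtx x P Γ ++ Γt) Ψ a b) : Reach Γt Ψ a b := by
  cases h with
  | @var y S q _ hm hb =>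
    rcases List.mem_append.1 hm with hm | hm
    · have hy : y ∈ names (substCtx x P Γ) := mem_names.2 ⟨_, hm, rfl⟩
      rw [names_substCtx, R.eq_of_fvar_mem_dom ha] at hy
      exact absurd hy hx
    · exact .var hm hb
  | loc hm hb => exact .loc hm hb

theorem ext (R : Replaces Γt Ψ x T p₀ P s) (hx : x ∉ names Γ) :
    Ext Γt Ψ (substCtx x P Γ ++ Γt) Ψ :=
  ⟨fun h => ⟨_, List.mem_append_right _ h⟩, fun h => ⟨_, h⟩, R.reach_of_append hx⟩

theorem mem_sat_of_mem_qual (hx : Atom.fvar x ∈ sat (Γ ++ [(x, T, p₀)]) Ψ q) (hb : b ∈ p₀) :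
    b ∈ sat (Γ ++ [(x, T, p₀)]) Ψ q :=
  mem_sat_of_reach hx (.var (List.mem_append_right _ List.mem_cons_self) hb)

theorem sat_subset (R : Replaces Γt Ψ x T p₀ P s) (hx : x ∉ names Γ) :
    sat (substCtx x P Γ ++ Γt) Ψ (Qual.subst x P q) ⊆
      Qual.subst x P (sat (Γ ++ [(x, T, p₀)]) Ψ q) := by
  refine sat_subset_of_closed (Qual.subst_mono subset_sat) fun a ha b hab => ?_
  rcases Qual.mem_replace.1 ha with ⟨ha, hax⟩ | ⟨hxq, ha⟩
  · cases hab with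
    | var hm hb =>
      rcases List.mem_append.1 hm with hm | hm
      · obtain ⟨S, q', hm', rfl, rfl⟩ := exists_mem_of_mem_substCtx hm
        refine Qual.subst_mono (fun c hc => ?_) hb
        exact mem_sat_of_reach ha (.var (List.mem_append_left _ hm') hc)
      · have := R.names_subset (mem_names.2 ⟨_, hm, rfl⟩)
        simp_all
    | loc hm hb => simp [R.wf.flat hm] at hb
  · have hab := R.reach ha (R.reach_of_append hx (R.wf.obs ha) hab)
    rcases Finset.mem_union.1 hab with hb | hb
    · exact Qual.mem_replace.2 (.inr ⟨hxq, hb⟩)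
    · refine Qual.mem_replace.2 (.inl ⟨mem_sat_of_mem_qual hxq hb, ?_⟩)
      rintro rfl
      exact fvar_notMem_domS (R.qual_subset hb)

theorem inter_sat_subset (R : Replaces Γt Ψ x T p₀ P s) (hx : x ∉ names Γ)
    (hp : sat (Γ ++ [(x, T, p₀)]) Ψ p ⊆ φ) (hq : sat (Γ ++ [(x, T, p₀)]) Ψ q ⊆ φ)
    (hP : P ∩ φ ⊆ p₀ ∪ {.fvar x}) :
    sat (substCtx x P Γ ++ Γt) Ψ (Qual.subst x P p) ∩
        sat (substCtx x P Γ ++ Γt) Ψ (Qual.subst x P q) ⊆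
      Qual.subst x P (sat (Γ ++ [(x, T, p₀)]) Ψ p ∩ sat (Γ ++ [(x, T, p₀)]) Ψ q) := by
  have mem_sat_of_obs {b : Atom} {q : Qual} (hxq : Atom.fvar x ∈ sat (Γ ++ [(x, T, p₀)]) Ψ q)
      (hbP : b ∈ P) (hbφ : b ∈ φ) (hbx : b ≠ .fvar x) : b ∈ sat (Γ ++ [(x, T, p₀)]) Ψ q :=
    mem_sat_of_mem_qual hxq
      ((Finset.mem_union.1 (hP (Finset.mem_inter.2 ⟨hbP, hbφ⟩))).resolve_right (by simpa using hbx))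
  intro b hb
  obtain ⟨hbp, hbq⟩ := Finset.mem_inter.1 hb
  rw [Qual.mem_replace, Finset.mem_inter, Finset.mem_inter]
  rcases Qual.mem_replace.1 (R.sat_subset hx hbp) with ⟨hbp, hbx⟩ | ⟨hxp, hbP⟩ <;>
    rcases Qual.mem_replace.1 (R.sat_subset hx hbq) with ⟨hbq, hbx'⟩ | ⟨hxq, hbP'⟩
  · exact .inl ⟨⟨hbp, hbq⟩, hbx⟩
  · exact .inl ⟨⟨hbp, mem_sat_of_obs hxq hbP' (hp hbp) hbx⟩, hbx⟩
  · exact .inl ⟨⟨mem_sat_of_obs hxp hbP (hq hbq) hbx', hbq⟩, hbx'⟩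
  · exact .inr ⟨⟨hxp, hxq⟩, hbP⟩

theorem inter_union_fvar_subset (R : Replaces Γt Ψ x T p₀ P s) (hP : P ∩ φ ⊆ p₀ ∪ {.fvar x})
    (hyx : y ≠ x) : P ∩ (φ ∪ {.fvar y}) ⊆ p₀ ∪ {.fvar x} := by
  have hy : Atom.fvar y ∉ P := fun hy => hyx (R.eq_of_fvar_mem_dom (R.wf.obs hy))
  rwa [Finset.inter_union_distrib_left, Finset.inter_singleton_of_notMem hy, Finset.union_empty]

theorem hasType_var (R : Replaces Γt Ψ x T p₀ P s) (hx : x ∉ names Γ)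
    (wf : WF (Γ ++ [(x, T, p₀)]) Ψ φ) (hm : (y, S, q) ∈ Γ ++ [(x, T, p₀)])
    (hy : Atom.fvar y ∈ φ) :
    HasType (substCtx x P Γ ++ Γt) Ψ (Qual.subst x P φ) ((Term.fvar y).subst x s) (S.subst x P)
      (Qual.subst x P {.fvar y}) ∅ := by
  rcases List.mem_append.1 hm with hm | hm
  · have hyx : y ≠ x := by
      have hy : y ∈ names Γ := mem_names.2 ⟨_, hm, rfl⟩
      grind
    rw [Qual.subst_singleton_of_ne (by simpa using hyx), Term.subst, if_neg hyx]
    exact .var (List.mem_append_left _ (mem_substCtx_of_mem hm))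
      (Qual.mem_replace.2 (.inl ⟨hy, by simpa using hyx⟩))
  · cases List.mem_singleton.1 hm
    have hxP : Qual.subst x P {.fvar x} = P := by
      ext
      simp [Qual.mem_replace]
    rw [R.ty_scoped.subst_eq fvar_notMem_domS, hxP, Term.subst, if_pos rfl]
    exact R.typed.weaken R.wf (R.ext hx) (R.subst_wf wf)
      fun a ha => Qual.mem_replace.2 (.inr ⟨hy, ha⟩)

theorem hasType_app {s₁ s₂ : Term C} {ε₁ ε₂ ε₃ : Qual} (R : Replaces Γt Ψ x T p₀ P s)
    (hx : x ∉ names Γ) (wf : WF (Γ ++ [(x, T, p₀)]) Ψ φ) (hP : P ∩ φ ⊆ p₀ ∪ {.fvar x})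
    (h₁ : HasType (substCtx x P Γ ++ Γt) Ψ (Qual.subst x P φ) s₁
      ((Ty.fn S (sat (Γ ++ [(x, T, p₀)]) Ψ p ∩ sat (Γ ++ [(x, T, p₀)]) Ψ q) ε₃ U r).subst x P)
      (Qual.subst x P q) (Qual.subst x P ε₁))
    (h₂ : HasType (substCtx x P Γ ++ Γt) Ψ (Qual.subst x P φ) s₂ (S.subst x P)
      (Qual.subst x P p) (Qual.subst x P ε₂))
    (hp : sat (Γ ++ [(x, T, p₀)]) Ψ p ⊆ φ) (hq : sat (Γ ++ [(x, T, p₀)]) Ψ q ⊆ φ)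
    (hU : U.NotFree 0) (hε : ε₃ ⊆ q ∪ {.bvar 0}) (hr : r ⊆ φ ∪ {.bvar 0}) :
    HasType (substCtx x P Γ ++ Γt) Ψ (Qual.subst x P φ) (.app s₁ s₂) ((U.inst 0 p).subst x P)
      (Qual.subst x P (Qual.inst 0 p r)) (Qual.subst x P (ε₁ ∪ ε₂ ∪ Qual.inst 0 p ε₃)) := by
  rw [Ty.subst_inst R.bvar_notMem, Qual.subst_inst R.bvar_notMem, Qual.subst_union,
    Qual.subst_union, Qual.subst_inst R.bvar_notMem]
  exact .app_of_subset (R.subst_wf wf) h₁ h₂ (R.inter_sat_subset hx hp hq hP)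
    ((R.sat_subset hx).trans (Qual.subst_mono hp)) ((R.sat_subset hx).trans (Qual.subst_mono hq))
    (hU.subst R.bvar_notMem) (Qual.subst_subset_union_bvar hε) (Qual.subst_subset_union_bvar hr)

end Replaces

theorem HasType.subst {Γ' : Ctx K} (h : HasType Γ' Ψ φ t U q ε) (hΓ : Γ' = Γ ++ [(x, T, p₀)])
    (hx : x ∉ names Γ) (R : Replaces Γt Ψ x T p₀ P s) (wf : WF Γ' Ψ φ)
    (hP : P ∩ φ ⊆ p₀ ∪ {.fvar x}) :
    HasType (substCtx x P Γ ++ Γt) Ψ (Qual.subst x P φ) (t.subst x s) (U.subst x P)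
      (Qual.subst x P q) (Qual.subst x P ε) := by
  induction h generalizing Γ with
  | cst c => exact .cst c
  | var hm hy => exact R.hasType_var hx (hΓ ▸ wf) (hΓ ▸ hm) hy
  | @loc _ Ψ φ l S q hm hl =>
    rw [((R.wf.simple hm).scoped ∅ 0).subst_eq (by simp), Qual.subst_singleton_of_ne (by simp)]
    exact .loc hm (Qual.mem_replace.2 (.inl ⟨hl, by simp⟩))
  | @abs Γ' Ψ φ t S U p q r ε L hS hp _ hq ih =>
    subst hΓ
    refine .abs (insert x L) (hS.subst R.subset_dom erase_dom_append_subset)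
      (R.subst_subset_dom hp) (fun y hy => ?_) (Qual.subst_mono hq)
    rw [Finset.mem_insert, not_or] at hy
    have hqP := R.inter_union_fvar_subset ((Finset.inter_subset_inter_left hq).trans hP) hy.1
    exact .named_of_subst_named R.typed.lc R.bvar_notMem hy.1
      (ih y hy.2 (Γ := (y, S, p) :: Γ) rfl (notMem_names_cons hx hy.1) R (wf.cons hq hS hp) hqP)
  | app _ _ hp hq hU hε hr ih₁ ih₂ =>
    subst hΓ
    exact R.hasType_app hx wf hP (ih₁ rfl hx R wf hP) (ih₂ rfl hx R wf hP) hp hq hU hε hr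
  | @letin Γ' Ψ φ t₁ t₂ S U p q ε₁ ε₂ L h₁ _ hU ih₁ ih₂ =>
    subst hΓ
    rw [Ty.subst_inst R.bvar_notMem, Qual.subst_inst R.bvar_notMem, Qual.subst_union,
      Qual.subst_inst R.bvar_notMem]
    obtain ⟨hS, hp, _⟩ := h₁.regular wf
    refine .letin_of_subset (R.subst_wf wf) (insert x L) (ih₁ rfl hx R wf hP)
      ((R.sat_subset hx).trans
        (Qual.subst_mono (Finset.subset_inter subset_rfl (sat_mono hp))))
      (R.subst_subset_dom wf.inter_sat_subset_dom) (fun y hy => ?_) (hU.subst R.bvar_notMem)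
    rw [Finset.mem_insert, not_or] at hy
    exact .named_of_subst_named R.typed.lc R.bvar_notMem hy.1
      (ih₂ y hy.2 (Γ := (y, S, _) :: Γ) rfl (notMem_names_cons hx hy.1) R
        (wf.cons subset_rfl hS wf.inter_sat_subset_dom) (R.inter_union_fvar_subset hP hy.1))
  | ref _ _ ih₁ ih₂ =>
    simpa only [Qual.subst_union] using
      .ref (ih₁ hΓ hx R wf hP) (ih₂ hΓ hx R wf hP)
  | deref _ ih => simpa only [Qual.subst_union] using .deref (ih hΓ hx R wf hP)
  | assign _ _ ih₁ ih₂ =>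
    simpa only [Qual.subst_union] using
      .assign (ih₁ hΓ hx R wf hP) (ih₂ hΓ hx R wf hP)
  | sub _ hsub hq hε ih =>
    subst hΓ
    exact .sub (ih rfl hx R wf hP) (hsub.subst R.subset_dom erase_dom_append_subset)
      (Qual.subst_mono hq) (Qual.subst_mono hε)

end Substitution

/-! ### Pruning qualifiers of base types -/

/-- The type is a base type. -/
def Ty.isBase : Ty K → Bool
  | .base _ => true
  | _ => false

/-- A choice of atoms to be pruned, extended to a new innermost bound variable of type `T`, which is
pruned unless `T` is a base type. -/
def extendBound (D : Atom → Bool) (T : Ty K) : Atom → Bool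
  | .bvar 0 => !T.isBase
  | .bvar (i + 1) => D (.bvar i)
  | a => D a

/-- A choice of atoms to be pruned, extended to a new variable `x` of type `T`, which is pruned
unless `T` is a base type. -/
def extendFree (D : Atom → Bool) (x : ℕ) (T : Ty K) : Atom → Bool :=
  Function.update D (.fvar x) (!T.isBase)

/-- The qualifier `q` of the type `T` without the atoms in `D` if `T` is a base type. -/
def Qual.prune (D : Atom → Bool) (T : Ty K) (q : Qual) : Qual :=
  if T.isBase then q.filter (fun a => D a = false) else q

/-- Homomorphic extension of `Qual.prune` to types. Effects are not pruned. -/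
def Ty.prune (D : Atom → Bool) : Ty K → Ty K
  | .base B => .base B
  | .fn T q ε U r =>
      .fn (T.prune D) (Qual.prune D T q) ε (U.prune (extendBound D T))
        (Qual.prune (extendBound D T) U r)
  | .ref B => .ref B

/-- Pruning of the types and qualifiers in a typing environment. -/
def Ctx.prune (D : Atom → Bool) (Γ : Ctx K) : Ctx K :=
  Γ.map fun e => (e.1, e.2.1.prune D, Qual.prune D e.2.1 e.2.2)

section Prune

variable {D D' : Atom → Bool} {E p p' q r : Qual} {S T U : Ty K} {a : Atom} {k x : ℕ}

namespace Ty

theorem isBase_inst : (T.inst k p).isBase = T.isBase := by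
  cases T <;> rfl

theorem Simple.prune_eq (h : T.Simple) : T.prune D = T := by
  cases T
  · rfl
  · exact h.elim
  · rfl

theorem NotFree.prune (h : T.NotFree k) : (T.prune D).NotFree k := by
  have notMem {D : Atom → Bool} {T : Ty K} {q : Qual} {k : ℕ} (hq : Atom.bvar k ∉ q) :
      Atom.bvar k ∉ Qual.prune D T q := by
    unfold Qual.prune
    split_ifs <;> simp [hq]
  induction T generalizing D k with
  | fn T q ε U r ihT ihU =>
    obtain ⟨hT, hq, hε, hU, hr⟩ := h
    exact ⟨ihT hT, notMem hq, hε, ihU hU, notMem hr⟩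
  | _ => trivial

end Ty

theorem TSub.isBase_eq {Γ : Ctx K} {Ψ : StoreTy K} (h : TSub Γ Ψ S T) : S.isBase = T.isBase := by
  cases h <;> rfl

namespace Qual

theorem mem_prune : a ∈ prune D T q ↔ a ∈ q ∧ (T.isBase = true → D a = false) := by
  unfold prune
  split_ifs with h <;> simp [h]

theorem prune_subset : prune D T q ⊆ q := fun _ h => (mem_prune.1 h).1

theorem prune_mono (hST : S.isBase = T.isBase) (h : p ⊆ q) : prune D S p ⊆ prune D T q := by
  intro a
  simp only [mem_prune, hST]
  exact fun ha => ⟨h ha.1, ha.2⟩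

theorem prune_singleton (h : T.isBase = true → D a = false) : prune D T {a} = {a} := by
  ext b
  simp only [mem_prune, Finset.mem_singleton]
  grind

theorem inst_prune_subset (hE : ∀ i, Atom.bvar i ∉ E) (hr : Scoped E 1 r) :
    inst 0 (prune D T p) (prune (extendBound D T) U r) ⊆ prune D (U.inst 0 p) (inst 0 p r) := by
  intro a ha
  simp only [mem_prune, mem_inst, Ty.isBase_inst] at ha ⊢
  rcases ha with ⟨⟨har, hD⟩, ha0⟩ | ⟨⟨h0r, hT⟩, hap, hD⟩
  · refine ⟨.inl ⟨har, ha0⟩, fun hU => ?_⟩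
    rcases hr a har with haE | ⟨i, hi, rfl⟩
    · cases a with
      | bvar i => exact absurd haE (hE i)
      | _ => exact hD hU
    · exact absurd (by rw [Nat.lt_one_iff.1 hi]) ha0
  · exact ⟨.inr ⟨h0r, hap⟩, fun hU => hD (by simpa [extendBound] using hT hU)⟩

end Qual

theorem Ty.Scoped.prune (h : T.Scoped E k) : (T.prune D).Scoped E k := by
  induction T generalizing k D with
  | fn T q ε U r ihT ihU =>
    obtain ⟨hT, hq, hε, hU, hr⟩ := h
    exact ⟨ihT hT, fun a ha => hq a (Qual.prune_subset ha), hε, ihU hU,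
      fun a ha => hr a (Qual.prune_subset ha)⟩
  | _ => trivial

/-- `D` and `D'` agree on the atoms of `E` and on the first `k` bound variables. -/
def Agree (E : Qual) (k : ℕ) (D D' : Atom → Bool) : Prop :=
  (∀ a ∈ E, D a = D' a) ∧ ∀ i < k, D (.bvar i) = D' (.bvar i)

namespace Agree

theorem extendFree (hx : Atom.fvar x ∉ E) : Agree E k (extendFree D x T) D :=
  ⟨fun _ ha => Function.update_of_ne (ne_of_mem_of_not_mem ha hx) _ _,
    fun _ _ => Function.update_of_ne (by simp) _ _⟩

theorem extendBound_self (hE : ∀ i, Atom.bvar i ∉ E) : Agree E 0 (extendBound D T) D := by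
  refine ⟨fun a ha => ?_, by simp⟩
  cases a with
  | bvar i => exact absurd ha (hE i)
  | _ => rfl

theorem extendBound (hE : ∀ i, Atom.bvar i ∉ E) (h : Agree E k D D') :
    Agree E (k + 1) (extendBound D T) (extendBound D' T) := by
  refine ⟨fun a ha => ?_, fun i hi => ?_⟩
  · rw [(extendBound_self hE).1 a ha, (extendBound_self hE).1 a ha, h.1 a ha]
  · cases i with
    | zero => rfl
    | succ i => exact h.2 i (Nat.lt_of_succ_lt_succ hi)

theorem qual_prune (h : Agree E k D D') (hq : Qual.Scoped E k q) :
    Qual.prune D T q = Qual.prune D' T q := by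
  ext a
  simp only [Qual.mem_prune]
  refine and_congr_right fun ha => ?_
  rcases hq a ha with ha | ⟨i, hi, rfl⟩
  · rw [h.1 a ha]
  · rw [h.2 i hi]

theorem ty_prune (hE : ∀ i, Atom.bvar i ∉ E) (h : Agree E k D D') (hT : T.Scoped E k) :
    T.prune D = T.prune D' := by
  induction T generalizing k D D' with
  | fn T q ε U r ihT ihU =>
    obtain ⟨hT, hq, _, hU, hr⟩ := hT
    simp only [Ty.prune, ihT h hT, h.qual_prune hq, ihU (h.extendBound hE) hU,
      (h.extendBound hE).qual_prune hr]
  | _ => rfl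

end Agree

/-- `D` and `D'` agree, but for the bound variable `k` of `D`, which is the variable `x` in `D'`. -/
def Opens (k x : ℕ) (D D' : Atom → Bool) : Prop :=
  D (.bvar k) = D' (.fvar x) ∧ ∀ b, b ≠ .bvar k → D b = D' b

namespace Opens

theorem extendBound (h : Opens k x D D') :
    Opens (k + 1) x (extendBound D T) (extendBound D' (T.inst k p)) := by
  refine ⟨h.1, fun b hb => ?_⟩
  cases b with
  | bvar i =>
    cases i with
    | zero => simp [LStar.extendBound, Ty.isBase_inst]
    | succ i => exact h.2 _ (by simpa using hb)
  | _ => exact h.2 _ (by simp)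

theorem extendFree (hD : ∀ i, D (.bvar i) = false) :
    Opens 0 x (LStar.extendBound (extendFree D x T) T) (extendFree D x T) := by
  refine ⟨by simp [LStar.extendBound, LStar.extendFree], fun b hb => ?_⟩
  cases b with
  | bvar i =>
    cases i with
    | zero => exact absurd rfl hb
    | succ i => simp [LStar.extendBound, LStar.extendFree, hD]
  | _ => rfl

theorem qual_prune (h : Opens k x D D') :
    Qual.prune D' (T.inst k p) (Qual.inst k {.fvar x} q) =
      Qual.inst k {.fvar x} (Qual.prune D T q) := by
  ext b
  simp only [Qual.mem_prune, Qual.mem_inst, Ty.isBase_inst, Finset.mem_singleton]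
  have hk := h.1
  have hb := h.2 b
  grind

theorem ty_prune (h : Opens k x D D') :
    (T.inst k {.fvar x}).prune D' = (T.prune D).inst k {.fvar x} := by
  induction T generalizing k D D' with
  | fn T q ε U r ihT ihU =>
    simp only [Ty.prune, Ty.inst, ihT h, ihU h.extendBound, h.qual_prune, h.extendBound.qual_prune]
  | _ => rfl

end Opens

theorem Ty.Scoped.prune_named (hU : U.Scoped E 1) (hD : ∀ i, D (.bvar i) = false)
    (hE : ∀ i, Atom.bvar i ∉ E) (hx : Atom.fvar x ∉ E) :
    (U.named x).prune (extendFree D x T) = (U.prune (extendBound D T)).named x := by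
  rw [(Opens.extendFree hD).ty_prune, ((Agree.extendFree hx).extendBound hE).ty_prune hE hU]

theorem Qual.Scoped.prune_named (hq : Qual.Scoped E 1 q) (hD : ∀ i, D (.bvar i) = false)
    (hE : ∀ i, Atom.bvar i ∉ E) (hx : Atom.fvar x ∉ E) :
    Qual.prune (extendFree D x T) (U.named x) (q.named x) =
      (Qual.prune (extendBound D T) U q).named x := by
  rw [(Opens.extendFree hD).qual_prune, ((Agree.extendFree hx).extendBound hE).qual_prune hq]

theorem extendFree_bvar (hD : ∀ i, D (.bvar i) = false) (i : ℕ) :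
    extendFree D x T (.bvar i) = false := by
  simp [extendFree, hD]

theorem Ty.Scoped.inst_prune_of_notFree (hU : U.Scoped E 1) (hU0 : U.NotFree 0)
    (hE : ∀ i, Atom.bvar i ∉ E) :
    (U.prune (extendBound D T)).inst 0 p' = (U.inst 0 p).prune D := by
  have hU' : U.Scoped E 0 := hU0.inst_eq ▸ hU.inst (Finset.empty_subset _)
  rw [hU0.inst_eq, hU0.prune.inst_eq, (Agree.extendBound_self hE).ty_prune hE hU']

end Prune

section PruneContexts

variable {D : Atom → Bool} {Γ : Ctx K} {Ψ : StoreTy K} {φ ψ p q r ε ε' : Qual} {S T U : Ty K}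
  {t : Term C} {a b : Atom} {x : ℕ}

theorem fvar_notMem_dom (hx : x ∉ names Γ) : Atom.fvar x ∉ dom Γ Ψ :=
  fun h => hx (fvar_mem_dom.1 h)

theorem QSub.prune (h : QSub Γ Ψ p q) (hST : S.isBase = T.isBase) :
    QSub Γ Ψ (Qual.prune D S p) (Qual.prune D T q) :=
  ⟨Qual.prune_mono hST h.1, Qual.prune_subset.trans h.2⟩

theorem TSub.prune (h : TSub Γ Ψ S T) (hD : ∀ i, D (.bvar i) = false) :
    TSub Γ Ψ (S.prune D) (T.prune D) := by
  induction h generalizing D with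
  | base => exact .base _
  | ref => exact .ref _
  | @fn Γ Ψ S T U V o p q r ε₁ ε₂ L hUS hpo hTV hqr hε ihUS ihTV =>
    obtain ⟨⟨_, _, _, hT, hq⟩, ⟨_, _, _, hV, hr⟩⟩ := (TSub.fn L hUS hpo hTV hqr hε).scoped
    have hbound : extendBound D S = extendBound D U := by
      funext a
      unfold extendBound
      rw [hUS.isBase_eq]
    have hE := bvar_notMem_dom (Γ := Γ) (Ψ := Ψ)
    simp only [Ty.prune, hbound]
    refine .fn (L ∪ names Γ) (ihUS hD) (hpo.prune hUS.isBase_eq) (fun x hx => ?_)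
      (fun x hx => ?_) (fun x hx => ?_) <;>
      obtain ⟨hxL, hxΓ⟩ := not_or.1 (mt Finset.mem_union.2 hx) <;>
      have hxd := fvar_notMem_dom (Ψ := Ψ) hxΓ
    · rw [← hT.prune_named hD hE hxd, ← hV.prune_named hD hE hxd]
      exact (ihTV x hxL (extendFree_bvar hD)).mono (dom_cons_subset subset_rfl)
    · rw [← hq.prune_named hD hE hxd, ← hr.prune_named hD hE hxd]
      exact ((hqr x hxL).prune (hTV x hxL).isBase_eq).mono (dom_cons_subset subset_rfl)
    · exact (hε x hxL).mono (dom_cons_subset subset_rfl)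

theorem dom_prune : dom (Γ.prune D) Ψ = dom Γ Ψ := by
  simp [dom, domC, Ctx.prune, Function.comp_def]

theorem mem_prune_of_mem (h : (x, T, q) ∈ Γ) : (x, T.prune D, Qual.prune D T q) ∈ Γ.prune D :=
  List.mem_map.2 ⟨_, h, rfl⟩

theorem exists_of_mem_prune (h : (x, T, q) ∈ Γ.prune D) :
    ∃ S r, (x, S, r) ∈ Γ ∧ S.prune D = T ∧ Qual.prune D S r = q := by
  obtain ⟨⟨y, S, r⟩, hm, he⟩ := List.mem_map.1 h
  cases he
  exact ⟨S, r, hm, rfl, rfl⟩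

/-- The atoms in `D` include the variables of function or reference type, but no variables or
locations of base type. -/
structure Prunable (D : Atom → Bool) (Γ : Ctx K) (Ψ : StoreTy K) : Prop where
  bvar (i : ℕ) : D (.bvar i) = false
  var {x : ℕ} {T : Ty K} {q : Qual} : (x, T, q) ∈ Γ → D (.fvar x) = !T.isBase
  loc {l : ℕ} {T : Ty K} {q : Qual} : (l, T, q) ∈ Ψ → T.isBase = true → D (.loc l) = false

theorem Prunable.cons (h : Prunable D Γ Ψ) (hx : x ∉ names Γ) :
    Prunable (extendFree D x T) ((x, T, q) :: Γ) Ψ := by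
  refine ⟨extendFree_bvar h.bvar, fun hm => ?_,
    fun hm hT => by simpa [extendFree] using h.loc hm hT⟩
  rcases List.mem_cons.1 hm with hm | hm
  · cases hm
    simp [extendFree]
  · rw [← h.var hm]
    refine Function.update_of_ne ?_ _ _
    rintro ⟨⟩
    exact hx (mem_names.2 ⟨_, hm, rfl⟩)

theorem WF.prune (wf : WF Γ Ψ φ) : WF (Γ.prune D) Ψ φ where
  ty h := by
    obtain ⟨S, r, hm, rfl, -⟩ := exists_of_mem_prune h
    exact (wf.ty hm).prune.mono dom_prune.superset le_rfl
  qual h := by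
    obtain ⟨S, r, hm, -, rfl⟩ := exists_of_mem_prune h
    exact (Qual.prune_subset.trans (wf.qual hm)).trans dom_prune.superset
  simple := wf.simple
  flat := wf.flat
  obs := wf.obs.trans dom_prune.superset

theorem WF.prune_cons (wf : WF Γ Ψ φ) (hx : x ∉ names Γ) (hT : T.Scoped (dom Γ Ψ) 0)
    (hq : q ⊆ dom Γ Ψ) :
    Ctx.prune (extendFree D x T) ((x, T, q) :: Γ) =
      (x, T.prune D, Qual.prune D T q) :: Γ.prune D := by
  have agree : Agree (dom Γ Ψ) 0 (extendFree D x T) D := .extendFree (fvar_notMem_dom hx)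
  simp only [Ctx.prune, List.map_cons, agree.ty_prune bvar_notMem_dom hT,
    agree.qual_prune (Qual.scoped_zero.2 hq), List.cons.injEq, true_and]
  refine List.map_congr_left fun ⟨y, S, r⟩ hm => ?_
  simp only [agree.ty_prune bvar_notMem_dom (wf.ty hm),
    agree.qual_prune (Qual.scoped_zero.2 (wf.qual hm))]

theorem Reach.of_prune (h : Reach (Γ.prune D) Ψ a b) : Reach Γ Ψ a b := by
  cases h with
  | var hm hb =>
    obtain ⟨S, r, hm', -, rfl⟩ := exists_of_mem_prune hm
    exact .var hm' (Qual.prune_subset hb)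
  | loc hm hb => exact .loc hm hb

theorem sat_prune_subset : sat (Γ.prune D) Ψ q ⊆ sat Γ Ψ q :=
  sat_subset_of_closed subset_sat fun _ ha _ h => mem_sat_of_reach ha h.of_prune

theorem Prunable.sat_subset (h : Prunable D Γ Ψ) (wf : WF Γ Ψ φ) :
    sat (Γ.prune D) Ψ (Qual.prune D T q) ⊆ Qual.prune D T (sat Γ Ψ q) := by
  refine sat_subset_of_closed (Qual.prune_mono rfl subset_sat) fun a ha b hab => ?_
  obtain ⟨ha, haD⟩ := Qual.mem_prune.1 ha
  refine Qual.mem_prune.2 ⟨mem_sat_of_reach ha hab.of_prune, fun hT => ?_⟩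
  cases hab with
  | var hm hb =>
    obtain ⟨S, r, hm', -, rfl⟩ := exists_of_mem_prune hm
    have hS := h.var hm'
    rw [haD hT] at hS
    exact (Qual.mem_prune.1 hb).2 (by simpa using hS.symm)
  | loc hm hb => simp [wf.flat hm] at hb

theorem Prunable.inter_sat_subset (h : Prunable D Γ Ψ) (wf : WF Γ Ψ φ) :
    sat (Γ.prune D) Ψ (Qual.prune D T p) ∩ sat (Γ.prune D) Ψ q ⊆
      Qual.prune D T (sat Γ Ψ p ∩ sat Γ Ψ q) := by
  intro a ha
  obtain ⟨hap, haq⟩ := Finset.mem_inter.1 ha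
  obtain ⟨hap, haD⟩ := Qual.mem_prune.1 (h.sat_subset wf hap)
  exact Qual.mem_prune.2 ⟨Finset.mem_inter.2 ⟨hap, sat_prune_subset haq⟩, haD⟩

namespace HasType

theorem prune_inst (h : HasType (Γ.prune D) Ψ φ t
      ((U.prune (extendBound D T)).inst 0 (Qual.prune D T p))
      (Qual.inst 0 (Qual.prune D T p) (Qual.prune (extendBound D T) U r))
      (ε ∪ Qual.inst 0 (Qual.prune D T p) ε'))
    (wf : WF Γ Ψ φ) (hU : U.Scoped (dom Γ Ψ) 1) (hU0 : U.NotFree 0)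
    (hr : Qual.Scoped (dom Γ Ψ) 1 r) (hrφ : Qual.inst 0 p r ⊆ φ)
    (hεφ : ε ∪ Qual.inst 0 p ε' ⊆ φ) :
    HasType (Γ.prune D) Ψ φ t ((U.inst 0 p).prune D)
      (Qual.prune D (U.inst 0 p) (Qual.inst 0 p r)) (ε ∪ Qual.inst 0 p ε') := by
  rw [← hU.inst_prune_of_notFree hU0 bvar_notMem_dom (T := T) (p' := Qual.prune D T p)]
  exact h.mono wf.prune (Qual.inst_prune_subset bvar_notMem_dom hr)
    (Qual.prune_subset.trans hrφ)
    (Finset.union_subset_union_right (Qual.replace_mono Qual.prune_subset subset_rfl)) hεφ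

theorem prune_body {L : Finset ℕ}
    (h : ∀ x ∉ L, HasType ((x, T, p) :: Γ) Ψ (ψ ∪ {.fvar x}) (t.named x) (U.named x) (r.named x)
      (ε.named x))
    (prune : ∀ x ∉ L, ∀ D, Prunable D ((x, T, p) :: Γ) Ψ →
      HasType (Ctx.prune D ((x, T, p) :: Γ)) Ψ (ψ ∪ {.fvar x}) (t.named x)
        ((U.named x).prune D) (Qual.prune D (U.named x) (r.named x)) (ε.named x))
    (hD : Prunable D Γ Ψ) (wf : WF Γ Ψ φ) (hψ : ψ ⊆ φ) (hT : T.Scoped (dom Γ Ψ) 0)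
    (hp : p ⊆ dom Γ Ψ) :
    ∀ x ∉ L ∪ names Γ,
      HasType ((x, T.prune D, Qual.prune D T p) :: Γ.prune D) Ψ (ψ ∪ {.fvar x}) (t.named x)
        ((U.prune (extendBound D T)).named x) ((Qual.prune (extendBound D T) U r).named x)
        (ε.named x) := by
  intro x hx
  obtain ⟨hxL, hxΓ⟩ := not_or.1 (mt Finset.mem_union.2 hx)
  obtain ⟨hU, hr, -⟩ := regular_body L h wf hψ hT hp
  rw [← wf.prune_cons hxΓ hT hp,
    ← hU.prune_named hD.bvar bvar_notMem_dom (fvar_notMem_dom hxΓ),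
    ← (hr.mono (hψ.trans wf.obs) le_rfl).prune_named hD.bvar bvar_notMem_dom (fvar_notMem_dom hxΓ)]
  exact prune x hxL _ (hD.cons hxΓ)

theorem prune (h : HasType Γ Ψ φ t T q ε) (hD : Prunable D Γ Ψ) (wf : WF Γ Ψ φ) :
    HasType (Γ.prune D) Ψ φ t (T.prune D) (Qual.prune D T q) ε := by
  induction h generalizing D with
  | cst c => exact .cst c
  | var hm hx =>
    rw [Qual.prune_singleton fun hT => by simp [hD.var hm, hT]]
    exact .var (mem_prune_of_mem hm) hx
  | loc hm hl =>
    rw [Qual.prune_singleton (hD.loc hm), (wf.simple hm).prune_eq]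
    exact .loc hm hl
  | abs L hT hp h hq ih =>
    exact .abs _ (hT.prune.mono dom_prune.superset le_rfl)
      ((Qual.prune_subset.trans hp).trans dom_prune.superset)
      (prune_body h (fun x hx _ hD => ih x hx hD (wf.cons hq hT hp)) hD wf hq hT hp) hq
  | app h₁ h₂ hp hq hU hε hr ih₁ ih₂ =>
    obtain ⟨⟨_, _, _, hU', hr'⟩, _⟩ := h₁.regular wf
    obtain ⟨_, hrφ, hεφ⟩ := (HasType.app h₁ h₂ hp hq hU hε hr).regular wf
    exact (app_of_subset wf.prune (ih₁ hD wf) (ih₂ hD wf) (hD.inter_sat_subset wf)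
      (((hD.sat_subset wf).trans Qual.prune_subset).trans hp) (sat_prune_subset.trans hq) hU.prune
      hε (Qual.prune_subset.trans hr)).prune_inst wf hU' hU hr' hrφ hεφ
  | @letin Γ Ψ φ t₁ t₂ S T p q ε₁ ε₂ L h₁ h₂ hT ih₁ ih₂ =>
    obtain ⟨hS, hp, -⟩ := h₁.regular wf
    obtain ⟨-, hqφ, hεφ⟩ := (HasType.letin L h₁ h₂ hT).regular wf
    have ho := wf.inter_sat_subset_dom (p := p)
    obtain ⟨hT', hq, -⟩ := regular_body L h₂ wf subset_rfl hS ho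
    have hpo : sat Γ Ψ p ⊆ sat Γ Ψ p ∩ sat Γ Ψ φ := Finset.subset_inter subset_rfl (sat_mono hp)
    exact (letin_of_subset wf.prune (L ∪ names Γ) (ih₁ hD wf)
      ((hD.sat_subset wf).trans (Qual.prune_mono rfl hpo))
      ((Qual.prune_subset.trans ho).trans dom_prune.superset)
      (prune_body h₂ (fun x hx _ hD => ih₂ x hx hD (wf.cons subset_rfl hS ho)) hD wf subset_rfl hS
        ho) hT.prune).prune_inst wf hT' hT (hq.mono wf.obs le_rfl) hqφ hεφ
  | ref h₁ h₂ ih₁ ih₂ =>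
    exact (HasType.ref (ih₁ hD wf) (ih₂ hD wf)).mono wf.prune (Finset.empty_subset _)
      (Qual.prune_subset.trans (Finset.empty_subset _))
      (Finset.union_subset_union_right Qual.prune_subset) ((HasType.ref h₁ h₂).regular wf).2.2
  | deref _ ih => exact .deref (ih hD wf)
  | assign _ _ ih₁ ih₂ => exact .assign (ih₁ hD wf) (ih₂ hD wf)
  | sub _ hsub hq hε ih =>
    obtain ⟨hST, hpq, hε₁₂⟩ := hsub
    exact .sub (ih hD wf)
      (.mono dom_prune.superset ⟨hST.prune hD.bvar, hpq.prune hST.isBase_eq, hε₁₂⟩)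
      (Qual.prune_subset.trans hq) hε

end HasType

end PruneContexts

/-! ### Stores -/

section Stores

variable {Γ : Ctx K} {Ψ : StoreTy K} {φ q r : Qual} {σ : Store C} {S T : Ty K} {l : ℕ}

theorem WF.nil (h : ∀ e ∈ Ψ, e.2.1.Simple ∧ e.2.2 = ∅) : WF [] Ψ (domS Ψ) :=
  ⟨fun h => by simp at h, fun h => by simp at h, fun hm => (h _ hm).1, fun hm => (h _ hm).2,
    dom_nil.superset⟩

namespace StoreOK

theorem simple (h : StoreOK Γ φ Ψ σ) : ∀ e ∈ Ψ, e.2.1.Simple ∧ e.2.2 = ∅ := by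
  induction h with
  | empty => simp
  | init w => simp [Ty.Simple]
  | ref _ _ _ _ ih => simpa [Ty.Simple] using ih

theorem wf (h : StoreOK Γ φ Ψ σ) : WF [] Ψ (domS Ψ) := .nil h.simple

theorem map_fst (h : StoreOK Γ φ Ψ σ) : σ.map Prod.fst = Ψ.map Prod.fst := by
  induction h with
  | empty => rfl
  | init w => rfl
  | ref _ _ _ _ ih => simp [ih]

theorem loc_notMem (h : StoreOK Γ φ Ψ σ) (hl : l ∉ σ.map Prod.fst) : Atom.loc l ∉ domS Ψ := by
  rw [h.map_fst] at hl
  simpa [domS] using hl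

theorem unique (h : StoreOK Γ φ Ψ σ) (hS : (l, S, q) ∈ Ψ) (hT : (l, T, r) ∈ Ψ) : S = T := by
  induction h with
  | empty => simp at hS
  | init w => simp_all
  | ref _ _ _ hl ih =>
    rcases List.mem_cons.1 hS with eS | hS' <;> rcases List.mem_cons.1 hT with eT | hT'
    · cases eS
      cases eT
      rfl
    · cases eS
      exact absurd (mem_domS_of_mem hT') hl
    · cases eT
      exact absurd (mem_domS_of_mem hS') hl
    · exact ih hS' hT'

theorem lookup {s : Term C} (h : StoreOK Γ φ Ψ σ) (hl : (l, Cell.ref s) ∈ σ) :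
    ∃ c : Const C, s = .const c ∧ (l, Ty.ref c.ty, ∅) ∈ Ψ := by
  induction h with
  | empty => simp at hl
  | init w => simp at hl
  | ref _ hs ht _ ih =>
    rcases List.mem_cons.1 hl with hl | hl
    · cases hl
      obtain ⟨c, rfl, rfl⟩ := ht.const_of_value hs
      exact ⟨c, rfl, List.mem_cons_self⟩
    · obtain ⟨c, hc, hm⟩ := ih hl
      exact ⟨c, hc, List.mem_cons_of_mem _ hm⟩

theorem observe (h : StoreOK Γ φ Ψ σ) (φ' : Qual) : StoreOK Γ φ' Ψ σ := by
  induction h with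
  | empty => exact .empty
  | init w => exact .init w
  | ref _ hs ht hl ih =>
    obtain ⟨c, rfl, rfl⟩ := ht.const_of_value hs
    exact .ref ih hs (.cst c) hl

theorem update {σ₁ σ₂ : Store C} {c c' : Const C}
    (h : StoreOK Γ φ Ψ (σ₁ ++ (l, .ref (.const c)) :: σ₂)) (hc : c'.ty = c.ty) :
    StoreOK Γ φ Ψ (σ₁ ++ (l, .ref (.const c')) :: σ₂) := by
  generalize hσ : σ₁ ++ (l, Cell.ref (.const c)) :: σ₂ = σ at h
  induction h generalizing σ₁ with
  | empty => simp at hσ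
  | init w =>
    cases σ₁ with
    | nil => cases hσ
    | cons e σ₁ => simp at hσ
  | ref h hs ht hl ih =>
    cases σ₁ with
    | nil =>
      cases hσ
      obtain ⟨d, hd, rfl⟩ := ht.const_of_value hs
      cases hd
      rw [← hc]
      exact .ref h (.const c') (.cst c') hl
    | cons e σ₁ =>
      cases hσ
      exact .ref (ih rfl) hs ht hl

end StoreOK

end Stores

/-! ### Growing store typings -/

/-- `Ψ'` extends `Ψ`, and `δ` consists of new locations that hold references; `δ` is what a
reduction step may add to qualifiers and effects. -/
structure Grow (Ψ Ψ' : StoreTy K) (δ : Qual) : Prop where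
  wf : WF [] Ψ (domS Ψ)
  wf' : WF [] Ψ' (domS Ψ')
  subset : Ψ ⊆ Ψ'
  qual_subset : δ ⊆ domS Ψ' \ domS Ψ
  isBase {l : ℕ} {T : Ty K} {q : Qual} : (l, T, q) ∈ Ψ' → Atom.loc l ∈ δ → T.isBase = false

section Closed

variable {Ψ : StoreTy K} {T U : Ty K} {o p q r ε ε₁ ε₂ ε₃ : Qual} {t t₁ t₂ : Term C}

theorem HasType.scoped_domS (h : HasType [] Ψ (domS Ψ) t T q ε) (wf : WF [] Ψ (domS Ψ)) :
    T.Scoped (domS Ψ) 0 :=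
  dom_nil.subst (motive := fun D => T.Scoped D 0) (h.regular wf).1

theorem HasType.app_of_inter_subset (wf : WF [] Ψ (domS Ψ))
    (h₁ : HasType [] Ψ (domS Ψ) t₁ (.fn T o ε₃ U r) q ε₁)
    (h₂ : HasType [] Ψ (domS Ψ) t₂ T p ε₂) (ho : p ∩ q ⊆ o) (hU : U.NotFree 0)
    (hε : ε₃ ⊆ q ∪ {.bvar 0}) (hr : r ⊆ domS Ψ ∪ {.bvar 0}) :
    HasType [] Ψ (domS Ψ) (.app t₁ t₂) (U.inst 0 p) (Qual.inst 0 p r)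
      (ε₁ ∪ ε₂ ∪ Qual.inst 0 p ε₃) :=
  .app_of_subset wf h₁ h₂ (by rwa [wf.sat_nil, wf.sat_nil])
    (by rw [wf.sat_nil]; exact (h₂.regular wf).2.1)
    (by rw [wf.sat_nil]; exact (h₁.regular wf).2.1) hU hε hr

end Closed

namespace Grow

variable {Ψ Ψ' : StoreTy K} {δ p p' q ε ε' ε₁ ε₂ : Qual} {S T : Ty K} {t : Term C}

theorem refl (wf : WF [] Ψ (domS Ψ)) : Grow Ψ Ψ ∅ :=
  ⟨wf, wf, List.Subset.refl _, by simp, by simp⟩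

theorem ref {l : ℕ} (wf : WF [] Ψ (domS Ψ)) (hl : Atom.loc l ∉ domS Ψ) (B : Base K) :
    Grow Ψ ((l, .ref B, ∅) :: Ψ) {.loc l} where
  wf := wf
  wf' := .nil (by
    simp only [List.mem_cons, forall_eq_or_imp]
    exact ⟨⟨trivial, trivial⟩, fun e he => ⟨wf.simple he, wf.flat he⟩⟩)
  subset := List.subset_cons_self _ _
  qual_subset := by simpa [domS_cons] using hl
  isBase hm h := by
    rcases List.mem_cons.1 hm with hm | hm
    · cases hm
      rfl
    · obtain ⟨⟩ := Finset.mem_singleton.1 h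
      exact absurd (mem_domS_of_mem hm) hl

theorem ext (g : Grow Ψ Ψ' δ) : Ext [] Ψ [] Ψ' := by
  refine ⟨fun h => by simp at h, fun h => ⟨_, g.subset h⟩, fun _ h => ?_⟩
  cases h with
  | var hm => simp at hm
  | loc hm hb => simp [g.wf'.flat hm] at hb

theorem domS_subset (g : Grow Ψ Ψ' δ) : domS Ψ ⊆ domS Ψ' := by
  simpa only [dom_nil] using g.ext.dom_subset

theorem qual_subset_domS (g : Grow Ψ Ψ' δ) : δ ⊆ domS Ψ' :=
  g.qual_subset.trans Finset.sdiff_subset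

theorem union_subset (g : Grow Ψ Ψ' δ) (hq : q ⊆ domS Ψ) : q ∪ δ ⊆ domS Ψ' :=
  Finset.union_subset (hq.trans g.domS_subset) g.qual_subset_domS

theorem bvar_notMem (g : Grow Ψ Ψ' δ) (i : ℕ) : Atom.bvar i ∉ δ :=
  bvar_notMem_of_subset_dom (g.qual_subset_domS.trans dom_nil.superset) i

theorem disjoint (g : Grow Ψ Ψ' δ) (hq : q ⊆ domS Ψ) : Disjoint q δ :=
  Finset.disjoint_of_subset_left hq (Finset.disjoint_of_subset_right g.qual_subset
    Finset.disjoint_sdiff)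

theorem weaken (g : Grow Ψ Ψ' δ) (h : HasType [] Ψ (domS Ψ) t T q ε) :
    HasType [] Ψ' (domS Ψ') t T q ε :=
  h.weaken g.wf g.ext g.wf' g.domS_subset

theorem prune {B : Base K} (g : Grow Ψ Ψ' δ)
    (h : HasType [] Ψ' (domS Ψ') t (.base B) (∅ ∪ δ) ε) :
    HasType [] Ψ' (domS Ψ') t (.base B) ∅ ε := by
  have hD : Prunable (fun a => decide (a ∈ δ)) [] Ψ' :=
    ⟨fun i => by simpa using g.bvar_notMem i, fun hm => by simp at hm, fun hm hT => by
      rw [decide_eq_false_iff_not]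
      intro hl
      simp [g.isBase hm hl] at hT⟩
  have hprune : Qual.prune (fun a => decide (a ∈ δ)) (.base B : Ty K) (∅ ∪ δ) = ∅ := by
    ext a
    simp [Qual.mem_prune, Ty.isBase]
  exact hprune ▸ h.prune hD g.wf'

theorem sub (g : Grow Ψ Ψ' δ) (h : HasType [] Ψ' (domS Ψ') t S p' ε') (hp : p' ⊆ p ∪ δ)
    (hε : ε' ⊆ ε₁ ∪ δ) (hsub : QTSub [] Ψ S p ε₁ T q ε₂) :
    HasType [] Ψ' (domS Ψ') t T (q ∪ δ) (ε₂ ∪ δ) := by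
  obtain ⟨hST, ⟨hpq, hq⟩, hε₁, hε₂⟩ := hsub
  have hqδ := g.union_subset (hq.trans dom_nil.subset)
  have hεδ := g.union_subset (hε₂.trans dom_nil.subset)
  exact .sub h ⟨hST.mono g.ext.dom_subset,
    ⟨hp.trans (Finset.union_subset_union_left hpq), hqδ.trans dom_nil.superset⟩,
    hε.trans (Finset.union_subset_union_left hε₁), hεδ.trans dom_nil.superset⟩ hqδ hεδ

end Grow

theorem Qual.inst_union_subset {k : ℕ} {p q δ : Qual} : inst k (p ∪ δ) q ⊆ inst k p q ∪ δ := by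
  intro a
  simp only [mem_inst, Finset.mem_union]
  tauto

/-! ### Replacement in `let` bodies -/

namespace Grow

variable {Ψ Ψ' : StoreTy K} {δ p q ε : Qual} {S T : Ty K} {t : Term C} {x : ℕ}

theorem subst_named (g : Grow Ψ Ψ' δ) (hq : Qual.Scoped (domS Ψ) 1 q) :
    Qual.subst x (δ ∪ {.fvar x}) (q.named x) =
      (Qual.inst 0 (δ ∪ {.bvar 0}) q).named x := by
  have hx : Atom.fvar x ∉ q := hq.fvar_notMem fvar_notMem_domS
  have := g.bvar_notMem 0
  ext a
  rw [Qual.subst_inst_fvar_self hx]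
  simp only [Qual.mem_inst, Finset.mem_union, Finset.mem_singleton]
  grind

theorem inst_inst_subset (g : Grow Ψ Ψ' δ) :
    Qual.inst 0 (p ∪ δ) (Qual.inst 0 (δ ∪ {.bvar 0}) q) ⊆ Qual.inst 0 p q ∪ δ := by
  intro a
  have := g.bvar_notMem 0
  simp only [Qual.mem_inst, Finset.mem_union, Finset.mem_singleton]
  grind

theorem replaces_self (g : Grow Ψ Ψ' δ) (hS : S.Scoped (domS Ψ) 0) (hp : p ⊆ domS Ψ) :
    Replaces [(x, S, p ∪ δ)] Ψ' x S p (δ ∪ {.fvar x}) (.fvar x : Term C) where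
  wf := g.wf'.cons g.qual_subset_domS (hS.mono (g.domS_subset.trans dom_nil.superset) le_rfl)
    ((g.union_subset hp).trans dom_nil.superset)
  names_subset := by simp [names]
  typed := by
    refine (HasType.var List.mem_cons_self (by simp)).mono (g.wf'.cons g.qual_subset_domS
      (hS.mono (g.domS_subset.trans dom_nil.superset) le_rfl)
      ((g.union_subset hp).trans dom_nil.superset)) Finset.subset_union_right
      subset_rfl subset_rfl (Finset.empty_subset _)
  ty_scoped := hS.mono g.domS_subset le_rfl
  qual_subset := hp.trans g.domS_subset
  reach _ h := by
    cases h with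
    | var hm hb =>
      simp only [List.mem_singleton, Prod.mk.injEq] at hm
      obtain ⟨rfl, rfl, rfl⟩ := hm
      grind
    | loc hm hb => simp [g.wf'.flat hm] at hb

theorem letin_body (g : Grow Ψ Ψ' δ) (hS : S.Scoped (domS Ψ) 0) (hp : p ⊆ domS Ψ)
    (hT : T.Scoped (domS Ψ) 0) (hq : Qual.Scoped (domS Ψ) 1 q) (hε : Qual.Scoped (domS Ψ) 1 ε)
    (h : HasType [(x, S, p)] Ψ (domS Ψ ∪ {.fvar x}) t T (q.named x) (ε.named x)) :
    HasType [(x, S, p ∪ δ)] Ψ' (domS Ψ' ∪ {.fvar x}) t T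
      ((Qual.inst 0 (δ ∪ {.bvar 0}) q).named x) ((Qual.inst 0 (δ ∪ {.bvar 0}) ε).named x) := by
  have hS' := hS.mono (g.domS_subset.trans dom_nil.superset) le_rfl
  have wfx : WF [(x, S, p)] Ψ (domS Ψ ∪ {.fvar x}) :=
    g.wf.cons subset_rfl (hS.mono dom_nil.superset le_rfl) (hp.trans dom_nil.superset)
  have wfx' : WF [(x, S, p)] Ψ' (domS Ψ ∪ {.fvar x}) :=
    g.wf'.cons g.domS_subset hS' ((hp.trans g.domS_subset).trans dom_nil.superset)
  have wfδ : WF [(x, S, p ∪ δ)] Ψ' (domS Ψ' ∪ {.fvar x}) :=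
    g.wf'.cons subset_rfl hS' ((g.union_subset hp).trans dom_nil.superset)
  have R : Replaces _ Ψ' x S p _ (.fvar x : Term C) := g.replaces_self hS hp
  have hδ : (δ ∪ {.fvar x}) ∩ (domS Ψ ∪ {.fvar x}) ⊆ p ∪ {.fvar x} := by
    have := Finset.disjoint_left.1 (g.disjoint (subset_refl (domS Ψ)))
    intro a
    grind
  have hweak := h.weaken wfx (g.ext.cons (by simp [names]) subset_rfl) wfx' subset_rfl
  have hsubst := hweak.subst (Γ := []) rfl (by simp [names]) R wfx' hδ
  rw [Term.subst_fvar_self, hT.subst_eq fvar_notMem_domS, g.subst_named hq, g.subst_named hε]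
    at hsubst
  have hobs : Qual.subst x (δ ∪ {.fvar x}) (domS Ψ ∪ {.fvar x}) ⊆ domS Ψ' ∪ {.fvar x} := by
    have := g.domS_subset
    have := g.qual_subset_domS
    intro a
    simp only [Qual.mem_replace, Finset.mem_union, Finset.mem_singleton]
    grind
  exact hsubst.weaken (wfδ.of_subset (hobs.trans wfδ.obs)) .refl wfδ hobs

theorem letin {t₁ t₂ : Term C} {ε₁ ε₂ : Qual} (g : Grow Ψ Ψ' δ) (L : Finset ℕ)
    (h₁ : HasType [] Ψ' (domS Ψ') t₁ S (p ∪ δ) ε₁) (hS : S.Scoped (domS Ψ) 0)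
    (hp : p ⊆ domS Ψ)
    (h₂ : ∀ x ∉ L, HasType [(x, S, p)] Ψ (domS Ψ ∪ {.fvar x}) (t₂.named x) (T.named x)
      (q.named x) (ε₂.named x))
    (hT : T.NotFree 0) :
    HasType [] Ψ' (domS Ψ') (.letin t₁ t₂) (T.inst 0 p)
      (Qual.inst 0 (p ∪ δ) (Qual.inst 0 (δ ∪ {.bvar 0}) q))
      (ε₁ ∪ Qual.inst 0 (p ∪ δ) (Qual.inst 0 (δ ∪ {.bvar 0}) ε₂)) := by
  obtain ⟨hT₁, hq, hε⟩ := HasType.regular_body L h₂ g.wf subset_rfl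
    (hS.mono dom_nil.superset le_rfl) (hp.trans dom_nil.superset)
  have hT₀ : T.Scoped (domS Ψ) 0 := by
    rw [← hT.inst_eq (p := ∅)]
    exact (hT₁.mono dom_nil.subset le_rfl).inst (Finset.empty_subset _)
  rw [hT.inst_eq, ← hT.inst_eq (p := p ∪ δ)]
  refine .letin_of_subset g.wf' L h₁ (by rw [g.wf'.sat_nil])
    ((g.union_subset hp).trans dom_nil.superset) (fun x hx => ?_) hT
  simp only [Ty.named, hT.inst_eq] at h₂ ⊢
  exact g.letin_body hS hp hT₀ hq hε (h₂ x hx)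

end Grow

/-! ### Replacement in evaluation contexts -/

/-- Every typing of `t` in `Ψ` yields a typing of `t'` in `Ψ'` whose qualifier and effect have grown
by `δ`. -/
def Retypes (Ψ Ψ' : StoreTy K) (δ : Qual) (t t' : Term C) : Prop :=
  ∀ ⦃T : Ty K⦄ ⦃q ε : Qual⦄, HasType [] Ψ (domS Ψ) t T q ε →
    HasType [] Ψ' (domS Ψ') t' T (q ∪ δ) (ε ∪ δ)

namespace Retypes

variable {Ψ Ψ' : StoreTy K} {δ : Qual} {t t' : Term C}

theorem appL (g : Grow Ψ Ψ' δ) (h : Retypes Ψ Ψ' δ t t') (u : Term C) :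
    Retypes Ψ Ψ' δ (.app t u) (.app t' u) := by
  intro T q ε ht
  obtain ⟨S, U, p, p₁, r, ε₁, ε₂, ε₃, h₁, h₂, -, -, hU, hε, hr, hsub⟩ := ht.app_inv g.wf
  have hp := g.disjoint (h₂.regular g.wf).2.1
  rw [g.wf.sat_nil, g.wf.sat_nil] at h₁
  have hinter : p ∩ (p₁ ∪ δ) ⊆ p ∩ p₁ := by
    rw [Finset.inter_union_distrib_left, Finset.disjoint_iff_inter_eq_empty.1 hp,
      Finset.union_empty]
  have happ := HasType.app_of_inter_subset g.wf' (h h₁) (g.weaken h₂) hinter hU (by grind)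
    (hr.trans (Finset.union_subset_union_left g.domS_subset))
  exact g.sub happ Finset.subset_union_left (by grind) hsub

theorem appR (g : Grow Ψ Ψ' δ) (h : Retypes Ψ Ψ' δ t t') (u : Term C) :
    Retypes Ψ Ψ' δ (.app u t) (.app u t') := by
  intro T q ε ht
  obtain ⟨S, U, p, p₁, r, ε₁, ε₂, ε₃, h₁, h₂, -, -, hU, hε, hr, hsub⟩ := ht.app_inv g.wf
  have hp₁ := g.disjoint (h₁.regular g.wf).2.1
  rw [g.wf.sat_nil, g.wf.sat_nil] at h₁
  have hinter : (p ∪ δ) ∩ p₁ ⊆ p ∩ p₁ := by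
    rw [Finset.union_inter_distrib_right, Finset.disjoint_iff_inter_eq_empty.1 hp₁.symm,
      Finset.union_empty]
  have happ := HasType.app_of_inter_subset g.wf' (g.weaken h₁) (h h₂) hinter hU hε
    (hr.trans (Finset.union_subset_union_left g.domS_subset))
  rw [hU.inst_eq, ← hU.inst_eq (p := p)] at happ
  have heff : Qual.inst 0 (p ∪ δ) ε₃ ⊆ _ := Qual.inst_union_subset
  exact g.sub happ Qual.inst_union_subset (by grind) hsub

theorem letin (g : Grow Ψ Ψ' δ) (h : Retypes Ψ Ψ' δ t t') (u : Term C) :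
    Retypes Ψ Ψ' δ (.letin t u) (.letin t' u) := by
  intro T q ε ht
  obtain ⟨S, U, p, r, ε₁, ε₂, L, h₁, h₂, hU, hsub⟩ := ht.letin_inv g.wf
  have hp := (h₁.regular g.wf).2.1
  rw [g.wf.sat_nil, g.wf.sat_nil, Finset.inter_eq_left.2 hp] at h₂
  have hlet := g.letin L (h h₁) (h₁.scoped_domS g.wf) hp h₂ hU
  have heff := g.inst_inst_subset (p := p) (q := ε₂)
  exact g.sub hlet g.inst_inst_subset (by grind) hsub

theorem refL (g : Grow Ψ Ψ' δ) (h : Retypes Ψ Ψ' δ t t') (u : Term C) :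
    Retypes Ψ Ψ' δ (.ref t u) (.ref t' u) := by
  intro T q ε ht
  obtain ⟨B, p, ε₁, ε₂, h₁, h₂, hsub⟩ := ht.ref_inv g.wf
  exact g.sub (.ref (h h₁) (g.weaken h₂)) (Finset.empty_subset _) (by grind) hsub

theorem refR (g : Grow Ψ Ψ' δ) (h : Retypes Ψ Ψ' δ t t') (u : Term C) :
    Retypes Ψ Ψ' δ (.ref u t) (.ref u t') := by
  intro T q ε ht
  obtain ⟨B, p, ε₁, ε₂, h₁, h₂, hsub⟩ := ht.ref_inv g.wf
  exact g.sub (.ref (g.weaken h₁) (g.prune (h h₂))) (Finset.empty_subset _) (by grind) hsub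

theorem deref (g : Grow Ψ Ψ' δ) (h : Retypes Ψ Ψ' δ t t') :
    Retypes Ψ Ψ' δ (.deref t) (.deref t') := by
  intro T q ε ht
  obtain ⟨B, p, ε₁, h₁, hsub⟩ := ht.deref_inv g.wf
  exact g.sub (.deref (h h₁)) (Finset.empty_subset _) (by grind) hsub

theorem assignL (g : Grow Ψ Ψ' δ) (h : Retypes Ψ Ψ' δ t t') (u : Term C) :
    Retypes Ψ Ψ' δ (.assign t u) (.assign t' u) := by
  intro T q ε ht
  obtain ⟨B, p, ε₁, ε₂, h₁, h₂, hsub⟩ := ht.assign_inv g.wf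
  exact g.sub (.assign (h h₁) (g.weaken h₂)) (Finset.empty_subset _) (by grind) hsub

theorem assignR (g : Grow Ψ Ψ' δ) (h : Retypes Ψ Ψ' δ t t') (u : Term C) :
    Retypes Ψ Ψ' δ (.assign u t) (.assign u t') := by
  intro T q ε ht
  obtain ⟨B, p, ε₁, ε₂, h₁, h₂, hsub⟩ := ht.assign_inv g.wf
  exact g.sub (.assign (g.weaken h₁) (g.prune (h h₂))) (Finset.empty_subset _) (by grind) hsub

theorem plug (g : Grow Ψ Ψ' δ) (h : Retypes Ψ Ψ' δ t t') (E : ECtx C) :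
    Retypes Ψ Ψ' δ (E.plug t) (E.plug t') := by
  induction E with
  | hole => exact h
  | appL E u ih => exact ih.appL g u
  | appR u _ E ih => exact ih.appR g u
  | refL E u ih => exact ih.refL g u
  | refR u _ E ih => exact ih.refR g u
  | deref E ih => exact ih.deref g
  | assignL E u ih => exact ih.assignL g u
  | assignR u _ E ih => exact ih.assignR g u
  | letin E u ih => exact ih.letin g u

end Retypes

theorem HasType.exists_of_plug {Γ : Ctx K} {Ψ : StoreTy K} {φ q ε : Qual} {t : Term C} {T : Ty K}
    {E : ECtx C} (h : HasType Γ Ψ φ (E.plug t) T q ε) (wf : WF Γ Ψ φ) :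
    ∃ (S : Ty K) (p ε' : Qual), HasType Γ Ψ φ t S p ε' := by
  induction E generalizing T q ε with
  | hole => exact ⟨T, q, ε, h⟩
  | appL E u ih =>
    obtain ⟨_, _, _, _, _, _, _, _, h₁, -⟩ := h.app_inv wf
    exact ih h₁
  | appR u _ E ih =>
    obtain ⟨_, _, _, _, _, _, _, _, -, h₂, -⟩ := h.app_inv wf
    exact ih h₂
  | refL E u ih =>
    obtain ⟨_, _, _, _, h₁, -⟩ := h.ref_inv wf
    exact ih h₁
  | refR u _ E ih =>
    obtain ⟨_, _, _, _, -, h₂, -⟩ := h.ref_inv wf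
    exact ih h₂
  | deref E ih =>
    obtain ⟨_, _, _, h₁, -⟩ := h.deref_inv wf
    exact ih h₁
  | assignL E u ih =>
    obtain ⟨_, _, _, _, h₁, -⟩ := h.assign_inv wf
    exact ih h₁
  | assignR u _ E ih =>
    obtain ⟨_, _, _, _, -, h₂, -⟩ := h.assign_inv wf
    exact ih h₂
  | letin E u ih =>
    obtain ⟨_, _, _, _, _, _, _, h₁, -⟩ := h.letin_inv wf
    exact ih h₁

/-! ### Contraction of redexes -/

section Instantiation

variable {Γ : Ctx K} {Ψ : StoreTy K} {p q r : Qual} {U V : Ty K} {e : Ty K × Qual}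

theorem TSub.inst_of_named (L : Finset ℕ) (hp : p ⊆ dom Γ Ψ)
    (h : ∀ x ∉ L, TSub ((x, e) :: Γ) Ψ (U.named x) (V.named x)) :
    TSub Γ Ψ (U.inst 0 p) (V.inst 0 p) := by
  have hU : U.Scoped (dom Γ Ψ) 1 := .of_inst_fvar L fun x hx => dom_cons ▸ (h x hx).scoped.1
  have hV : V.Scoped (dom Γ Ψ) 1 := .of_inst_fvar L fun x hx => dom_cons ▸ (h x hx).scoped.2
  obtain ⟨x, hx⟩ := Infinite.exists_notMem_finset (L ∪ names Γ)
  rw [Finset.mem_union, not_or] at hx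
  have hsubst := (h x hx.1).subst (x := x) (Γ' := Γ) hp (by rw [dom_cons]; grind)
  rwa [hU.subst_inst_fvar_self (fvar_notMem_dom hx.2),
    hV.subst_inst_fvar_self (fvar_notMem_dom hx.2)] at hsubst

theorem QSub.inst_of_named (L : Finset ℕ) (hp : p ⊆ dom Γ Ψ)
    (h : ∀ x ∉ L, QSub ((x, e) :: Γ) Ψ (q.named x) (r.named x)) :
    QSub Γ Ψ (Qual.inst 0 p q) (Qual.inst 0 p r) := by
  obtain ⟨hq, hr⟩ := scoped_of_named L h
  obtain ⟨x, hx⟩ := Infinite.exists_notMem_finset (L ∪ names Γ)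
  rw [Finset.mem_union, not_or] at hx
  have hsubst := (h x hx.1).subst (x := x) (Γ' := Γ) hp (by rw [dom_cons]; grind)
  rwa [Qual.subst_inst_fvar_self (hq.fvar_notMem (fvar_notMem_dom hx.2)),
    Qual.subst_inst_fvar_self (hr.fvar_notMem (fvar_notMem_dom hx.2))] at hsubst

end Instantiation

section Contraction

variable {Ψ : StoreTy K} {p p₀ φ q r ε : Qual} {S T U : Ty K} {s t : Term C} {l : ℕ}

theorem HasType.inst_value (wf : WF [] Ψ (domS Ψ)) (L : Finset ℕ) (hS : S.Scoped (domS Ψ) 0)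
    (hp₀ : p₀ ⊆ domS Ψ) (hp : p ⊆ domS Ψ) (hφ : φ ⊆ domS Ψ) (hpφ : p ∩ φ ⊆ p₀)
    (hs : HasType [] Ψ p s S p ∅)
    (h : ∀ x ∉ L, HasType [(x, S, p₀)] Ψ (φ ∪ {.fvar x}) (t.named x) (U.named x) (r.named x)
      (ε.named x)) :
    HasType [] Ψ (domS Ψ) (t.inst 0 s) (U.inst 0 p) (Qual.inst 0 p r) (Qual.inst 0 p ε) := by
  have hS' := hS.mono dom_nil.superset le_rfl
  have hp₀' := hp₀.trans dom_nil.superset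
  obtain ⟨hU, hr, hε⟩ := HasType.regular_body L h wf hφ hS' hp₀'
  obtain ⟨x, hx⟩ := Infinite.exists_notMem_finset (L ∪ t.fv)
  rw [Finset.mem_union, not_or] at hx
  have hxφ : Atom.fvar x ∉ φ := fun h => fvar_notMem_domS (hφ h)
  have R : Replaces [] Ψ x S p₀ p s := by
    refine ⟨wf.of_subset (hp.trans dom_nil.superset), by simp [names], hs, hS, hp₀, fun _ h => ?_⟩
    cases h with
    | var hm => simp at hm
    | loc hm hb => simp [wf.flat hm] at hb
  have hsubst := (h x hx.1).subst (Γ := []) rfl (by simp [names]) R (wf.cons hφ hS' hp₀')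
    (by grind)
  rw [Term.subst_inst_fvar_self hx.2, hU.subst_inst_fvar_self (fvar_notMem_dom (by simp [names])),
    Qual.subst_inst_fvar_self (hr.fvar_notMem hxφ),
    Qual.subst_inst_fvar_self (hε.fvar_notMem hxφ)] at hsubst
  have hobs : Qual.subst x p (φ ∪ {.fvar x}) ⊆ domS Ψ :=
    Qual.replace_subset (Finset.union_subset_union_left hφ) hp
  exact hsubst.weaken (wf.of_subset (hobs.trans dom_nil.superset)) .refl wf hobs

theorem HasType.beta (h : HasType [] Ψ (domS Ψ) (.app (.lam t) s) T q ε)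
    (wf : WF [] Ψ (domS Ψ)) (hs : Value s) : HasType [] Ψ (domS Ψ) (t.inst 0 s) T q ε := by
  obtain ⟨S, U, p, p₁, r, ε₁, ε₂, ε₃, h₁, h₂, -, -, -, -, -, hsub⟩ := h.app_inv wf
  have hp := (h₂.regular wf).2.1
  have hp₁ := (h₁.regular wf).2.1
  have hp' := hp.trans dom_nil.superset
  rw [wf.sat_nil, wf.sat_nil] at h₁
  obtain ⟨S', U', o, r', ε', p₁', L, hS', ho, hbody, hp₁', hfn⟩ := h₁.lam_inv wf
  cases hfn with
  | fn L' hS hpo hU hr hε =>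
    have harg : HasType [] Ψ p s S' p ∅ := .sub (h₂.value hs wf)
      ⟨hS, ⟨subset_rfl, hp'⟩, subset_rfl, Finset.empty_subset _⟩ subset_rfl (Finset.empty_subset _)
    have hinter : p ∩ p₁' ⊆ o := (Finset.inter_subset_inter_left hp₁').trans hpo.1
    have hinst := HasType.inst_value wf L (hS'.mono dom_nil.subset le_rfl) (ho.trans dom_nil.subset)
      hp (hp₁'.trans hp₁) hinter harg hbody
    have heff := (QSub.inst_of_named L' hp' hε).1.trans
      (Finset.subset_union_right (s₁ := ε₁ ∪ ε₂))
    have hinst_sub : QTSub [] Ψ (U'.inst 0 p) (Qual.inst 0 p r') (Qual.inst 0 p ε') (U.inst 0 p)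
        (Qual.inst 0 p r) (ε₁ ∪ ε₂ ∪ Qual.inst 0 p ε₃) :=
      ⟨.inst_of_named L' hp' hU, .inst_of_named L' hp' hr, heff,
        hsub.2.2.1.trans hsub.2.2.2⟩
    exact .sub hinst (hinst_sub.trans hsub) (hsub.2.1.2.trans dom_nil.subset)
      (hsub.2.2.2.trans dom_nil.subset)

theorem HasType.let_beta (h : HasType [] Ψ (domS Ψ) (.letin s t) T q ε)
    (wf : WF [] Ψ (domS Ψ)) (hs : Value s) : HasType [] Ψ (domS Ψ) (t.inst 0 s) T q ε := by
  obtain ⟨S, U, p, r, ε₁, ε₂, L, h₁, h₂, -, hU, ⟨hr, hq⟩, hε₁, hε⟩ := h.letin_inv wf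
  have hp := (h₁.regular wf).2.1
  rw [wf.sat_nil, wf.sat_nil, Finset.inter_eq_left.2 hp] at h₂
  have hinst := HasType.inst_value wf L (h₁.scoped_domS wf) hp hp subset_rfl
    Finset.inter_subset_left (h₁.value hs wf) h₂
  exact .sub hinst ⟨hU, ⟨hr, hq⟩, Finset.subset_union_right.trans hε₁, hε⟩
    (hq.trans dom_nil.subset) (hε.trans dom_nil.subset)

theorem HasType.loc_ref_inv {Γ : Ctx K} {B : Base K}
    (h : HasType (C := C) Γ Ψ φ (.loc l) (.ref B) q ε) (wf : WF Γ Ψ φ) :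
    ∃ r, (l, .ref B, r) ∈ Ψ := by
  obtain ⟨S, r, hm, hS, -⟩ := h.loc_inv wf
  cases hS
  exact ⟨r, hm⟩

variable {a : Term C} {c : Const C} {σ σ' : Store C} {t' : Term C}

theorem Retypes.of_forall_hasType
    (h : ∀ ⦃T : Ty K⦄ ⦃q ε : Qual⦄, HasType [] Ψ (domS Ψ) t T q ε →
      HasType [] Ψ (domS Ψ) t' T q ε) : Retypes Ψ Ψ ∅ t t' := by
  simpa only [Retypes, Finset.union_empty] using h

theorem Retypes.alloc (wf : WF [] Ψ (domS Ψ)) (hl : Atom.loc l ∉ domS Ψ) :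
    Retypes Ψ ((l, .ref c.ty, ∅) :: Ψ) {.loc l} (.ref a (.const c)) (.loc l) := by
  intro T q ε h
  have g := Grow.ref wf hl c.ty
  obtain ⟨B, p, ε₁, ε₂, -, h₂, hsub⟩ := h.ref_inv wf
  obtain ⟨_, ⟨⟩, rfl⟩ := h₂.const_of_value (.const c)
  have hloc : HasType (C := C) [] ((l, .ref c.ty, ∅) :: Ψ) (domS ((l, .ref c.ty, ∅) :: Ψ))
      (.loc l) (.ref c.ty) {.loc l} ∅ :=
    .loc List.mem_cons_self (mem_domS_of_mem List.mem_cons_self)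
  exact g.sub hloc Finset.subset_union_right (Finset.empty_subset _) hsub

theorem StoreOK.retypes_deref (hσ : StoreOK [] (domS Ψ) Ψ σ) (hl : (l, .ref s) ∈ σ) :
    Retypes Ψ Ψ ∅ (.deref (.loc l)) s := by
  intro T q ε h
  obtain ⟨c, rfl, hc⟩ := hσ.lookup hl
  obtain ⟨B, p, ε₁, h₁, hsub⟩ := h.deref_inv hσ.wf
  obtain ⟨r, hB⟩ := h₁.loc_ref_inv hσ.wf
  cases hσ.unique hB hc
  exact (Grow.refl hσ.wf).sub (.cst c) (Finset.empty_subset _) (Finset.empty_subset _) hsub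

theorem Retypes.assign (wf : WF [] Ψ (domS Ψ)) :
    Retypes Ψ Ψ ∅ (.assign t s) (.const .unit) := by
  intro T q ε h
  obtain ⟨B, p, ε₁, ε₂, -, -, hsub⟩ := h.assign_inv wf
  exact (Grow.refl wf).sub (.cst .unit) (Finset.empty_subset _) (Finset.empty_subset _) hsub

theorem StoreOK.assign {σ₁ σ₂ : Store C} {s' : Term C}
    (hσ : StoreOK [] (domS Ψ) Ψ (σ₁ ++ (l, .ref s) :: σ₂))
    (h : HasType [] Ψ (domS Ψ) (.assign (.loc l) s') T q ε) (hs' : Value s') :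
    StoreOK [] (domS Ψ) Ψ (σ₁ ++ (l, .ref s') :: σ₂) := by
  obtain ⟨B, p, ε₁, ε₂, h₁, h₂, -⟩ := h.assign_inv hσ.wf
  obtain ⟨r, hB⟩ := h₁.loc_ref_inv hσ.wf
  obtain ⟨c, rfl, hc⟩ := hσ.lookup (List.mem_append_right _ List.mem_cons_self)
  obtain ⟨c', rfl, rfl⟩ := h₂.const_of_value hs'
  exact hσ.update (Ty.ref.inj (hσ.unique hB hc))

theorem Head.preservation (hr : Head σ t σ' t') (h : HasType [] Ψ (domS Ψ) t T q ε)
    (hσ : StoreOK [] (domS Ψ) Ψ σ) :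
    ∃ Ψ' δ, Grow Ψ Ψ' δ ∧ Retypes Ψ Ψ' δ t t' ∧ StoreOK [] (domS Ψ') Ψ' σ' := by
  have wf := hσ.wf
  cases hr with
  | beta hs =>
    exact ⟨Ψ, ∅, .refl wf, .of_forall_hasType fun _ _ _ h => h.beta wf hs, hσ⟩
  | letin hs =>
    exact ⟨Ψ, ∅, .refl wf, .of_forall_hasType fun _ _ _ h => h.let_beta wf hs, hσ⟩
  | ref _ hs hl =>
    obtain ⟨B, _, _, _, -, h₂, -⟩ := h.ref_inv wf
    obtain ⟨c, rfl, rfl⟩ := h₂.const_of_value hs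
    have hl := hσ.loc_notMem hl
    exact ⟨_, _, .ref wf hl c.ty, .alloc wf hl, .ref (hσ.observe _) hs (.cst c) hl⟩
  | deref =>
    exact ⟨Ψ, ∅, .refl wf,
      hσ.retypes_deref (List.mem_append_right _ List.mem_cons_self), hσ⟩
  | assign hs =>
    exact ⟨Ψ, ∅, .refl wf, .assign wf, hσ.assign h hs⟩

end Contraction

end LStar

theorem mainTheorem6 {K : Type*} {C : K → Type*}
    (Ψ : LStar.StoreTy K) (σ σ' : LStar.Store C) (t t' : LStar.Term C)
    (T : LStar.Ty K) (q ε : LStar.Qual)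
    (ht : LStar.HasType [] Ψ (LStar.domS Ψ) t T q ε)
    (hσ : LStar.StoreOK [] (LStar.domS Ψ) Ψ σ)
    (hstep : LStar.Step σ t σ' t') :
    ∃ Ψ' : LStar.StoreTy K, Ψ ⊆ Ψ' ∧
      ∃ p : LStar.Qual, p ⊆ LStar.domS Ψ' \ LStar.domS Ψ ∧
        LStar.HasType [] Ψ' (LStar.domS Ψ') t' T (q ∪ p) (ε ∪ p) ∧
        LStar.StoreOK [] (LStar.domS Ψ') Ψ' σ' := by
  cases hstep with
  | ctx E hr =>
    obtain ⟨S, p, ε₀, hredex⟩ := ht.exists_of_plug hσ.wf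
    obtain ⟨Ψ', δ, g, hδ, hσ'⟩ := hr.preservation hredex hσ
    exact ⟨Ψ', g.subset, δ, g.qual_subset, hδ.plug g E ht, hσ'⟩
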